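/- Let $M$ be a smooth manifold of real dimension $2n$ with a generalized Kähler structure, written in its metric splitting: $g$ is a Riemannian metric, $H$ a closed 3-form, and $\mathbb{J}_1,\mathbb{J}_2$ are commuting complex structures on $T\oplus T^*$, orthogonal for the pairing $(X+\xi,Y+\eta)=\xi(Y)+\eta(X)$, whose $\sqrt{-1}$-eigenbundles are involutive for the $H$-twisted Courant bracket, and $-\mathbb{J}_1\mathbb{J}_2(X+\xi)=g^{-1}\xi+gX$. Let $J_\pm$ be the underlying $g$-orthogonal complex structures, defined by $\mathbb{J}_1(X\pm gX)=-(J_\pm X\pm gJ_\pm X)$. Put $T^*_{\pm1,0}=\{\xi\in T^*\otimes\mathbb{C}:\xi\circ J_\pm=\sqrt{-1}\,\xi\}$, $T^*_{\pm0,1}=\{\xi\in T^*\otimes\mathbb{C}:\xi\circ J_\pm=-\sqrt{-1}\,\xi\}$ and $K_\pm=\wedge^nT^*_{\pm1,0}$, and let $K_\pm^{1/2}$ be complex lines over the points of $M$ with isomorphisms $K_\pm^{1/2}\otimes K_\pm^{1/2}\cong K_\pm$. Let $S_1=\wedge^\bullet T^*_{+0,1}\otimes K_+^{1/2}$ and $S_2=\wedge^\bullet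 T^*_{-0,1}\otimes K_-^{1/2}$, with the Clifford multiplication $v\cdot(\alpha\otimes s)=\sqrt2\,(\iota_{v^{0,1}}\alpha+g(v^{1,0})\wedge\alpha)\otimes s$ of $v\in T$, where the types are those of $J_+$ on $S_1$ and of $J_-$ on $S_2$ and $g$ is extended complex-bilinearly; here $v\cdot w+w\cdot v=2g(v,w)$. Let $\rho:Cl(T,g)\otimes\mathbb{C}\to\mathrm{End}(S_1)$ be the resulting representation, and let $\mathfrak{J}:Cl(T,g)\otimes\mathbb{C}\to\wedge^\bullet T^*\otimes\mathbb{C}$ be the symbol map, $e_1\cdots e_p\mapsto g(e_1)\wedge\cdots\wedge g(e_p)$ for orthogonal $e_i$. Let $q$ be the complex-bilinear form on $S_1$ with $q(\alpha\otimes s_0,\beta\otimes s_0)=(\mu(\alpha)\wedge\beta)_{top}/\overline{s_0^2}$ for every $s_0\in K_+^{1/2}$ whose square $s_0^2\in K_+$ has length one, where $\mu$ reverses the order of products and $top$ is the component in $\wedge^nT^*_{+0,1}$; put $q^\sharp(\phi\otimes\psi)(\chi)=q(\psi,\chi)\phi$. Let $p:S_2\to S_1$ be, at each point, a complex-linear isomorphism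 commuting with the Clifford multiplication of all $v\in T$ (for example an equivariant isometry), and let $$q^\flat=\mathfrak{J}\circ\rho^{-1}\circ q^\sharp\circ(\mathrm{Id}\otimes p):S_1\otimes S_2\to\wedge^\bullet T^*\otimes\mathbb{C}.$$ Let $T\oplus T^*$ act on forms by $(X+\xi)\cdot\Phi=\iota_X\Phi+\xi\wedge\Phi$. The spin lift of $A\in\mathfrak{so}(T\oplus T^*)$ is the operator on forms in the span of the commutators $[u\cdot,w\cdot]$ whose commutator with $u\cdot$ is $(Au)\cdot$ for all $u\in T\oplus T^*$. Let $U_{n,0}\subset\wedge^\bullet T^*\otimes\mathbb{C}$ be the subspace on which the spin lifts of $\mathbb{J}_1$ and $\mathbb{J}_2$ act as $n\sqrt{-1}$ and $0$. Then at every point of $M$ the maps $\rho$ and $q^\flat$ are isomorphisms, and $q^\flat(K_+^{1/2}\otimes K_-^{1/2})=U_{n,0}$, where $K_\pm^{1/2}$ is regarded as the degree-zero part $\wedge^0\otimes K_\pm^{1/2}$ of $S_1$ (for $+$) and of $S_2$ (for $-$). -/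

import Mathlib

open scoped Bundle ContDiff Manifold TensorProduct RealInnerProductSpace
open Module

noncomputable section

namespace GenKahler

/-! ## Linear algebra in one tangent space `V` with metric `g = ⟪·,·⟫` -/

section Fibre

variable {V : Type*} [NormedAddCommGroup V] [InnerProductSpace ℝ V]

/-- The lowering map `g : V → V^*`, `v ↦ ⟪v, ·⟫`. -/
def flat : V →ₗ[ℝ] Dual ℝ V := innerₗ V

/-- The inclusion `V^* → V^* ⊗ ℂ`. Complex covectors are modelled as real-linear maps `V → ℂ`. -/
def cplx : Dual ℝ V →ₗ[ℝ] (V →ₗ[ℝ] ℂ) := LinearMap.compRight ℝ (Algebra.linearMap ℝ ℂ)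

/-- Evaluation of complex covectors at a real vector. -/
def evalAt : V →ₗ[ℝ] Dual ℂ (V →ₗ[ℝ] ℂ) where
  toFun v := { toFun := fun ξ => ξ v, map_add' := fun _ _ => rfl, map_smul' := fun _ _ => rfl }
  map_add' v w := by ext ξ; simp
  map_smul' r v := by ext ξ; simp

variable (V) in
/-- Complex differential forms at a point: `⋀^• (V^* ⊗ ℂ)`. -/
abbrev Forms : Type _ := ExteriorAlgebra ℂ (V →ₗ[ℝ] ℂ)

/-- For complex covectors `ξ₁, …, ξₘ` in a subspace `W`, the map sending `ξ₁ ∧ … ∧ ξₘ` to its value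
`det (ξᵢ(vⱼ))` on the vectors `v₁, …, vₘ`; it is zero on forms of degree other than `m`. -/
def evalForm (W : Submodule ℂ (V →ₗ[ℝ] ℂ)) {m : ℕ} (v : Fin m → V) :
    ExteriorAlgebra ℂ W →ₗ[ℂ] ℂ :=
  ExteriorAlgebra.liftAlternating (Pi.single m
    (Matrix.detRowAlternating.compLinearMap
      (LinearMap.pi fun j => (evalAt (v j)).comp W.subtype)))

/-! ### The generalized tangent space `V ⊕ V^*` and its spinors -/

variable (V) in
/-- The generalized tangent space `V ⊕ V^*`. -/
abbrev GTan : Type _ := V × Dual ℝ V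

/-- The natural pairing `(X + ξ, Y + η) = ξ(Y) + η(X)`. -/
def pairing (A B : GTan V) : ℝ := A.2 B.1 + B.2 A.1

/-- Clifford multiplication of `V ⊕ V^*` on forms: `(X + ξ) · Φ = ι_X Φ + ξ ∧ Φ`. -/
def gact (A : GTan V) : Module.End ℂ (Forms V) :=
  CliffordAlgebra.contractLeft (Q := (0 : QuadraticForm ℂ (V →ₗ[ℝ] ℂ))) (evalAt A.1)
    + LinearMap.mulLeft ℂ (ExteriorAlgebra.ι ℂ (cplx A.2))

/-- The image in `spin(V ⊕ V^*)`, acting on forms, of `A ∈ so(V ⊕ V^*)`. It is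
`¼ ∑ₐ [A(eₐ)·, eᵃ·]` for a basis `(eₐ)` of `V ⊕ V^*` and the dual basis `(eᵃ)` with respect to the
pairing; `(eₐ) = (bᵢ, bⁱ)` has the dual basis `(eᵃ) = (bⁱ, bᵢ)`. It is the element of the linear
span of the commutators `[u·, w·]` whose commutator with `u·` is `(A u)·`. -/
def spinLift [FiniteDimensional ℝ V] (A : GTan V →ₗ[ℝ] GTan V) : Module.End ℂ (Forms V) :=
  (1 / 4 : ℂ) • ∑ i,
    (⁅gact (A (Module.finBasis ℝ V i, 0)), gact ((0, (Module.finBasis ℝ V).coord i) : GTan V)⁆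
    + ⁅gact (A (0, (Module.finBasis ℝ V).coord i)), gact ((Module.finBasis ℝ V i, 0) : GTan V)⁆)

/-! ### The Clifford algebra of `(V, g)` -/

variable (V) in
/-- The quadratic form `v ↦ g(v, v)`; in its Clifford algebra `v w + w v = 2 g(v, w)`. -/
def metricForm : QuadraticForm ℝ V := LinearMap.BilinMap.toQuadraticMap (innerₗ V)

/-- The complex-linear extension to `Cl(V, Q) ⊗ ℂ` of the algebra map induced by a real-linear map
`f` from `V` to a complex algebra with `f(v)² = Q(v)`. -/
def complexLift (Q : QuadraticForm ℝ V) {A : Type*} [Ring A] [Algebra ℂ A] (f : V → A)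
    (hadd : ∀ v w, f (v + w) = f v + f w) (hsmul : ∀ (r : ℝ) v, f (r • v) = (r : ℂ) • f v)
    (hsq : ∀ v, f v * f v = algebraMap ℂ A (Q v : ℝ)) : ℂ ⊗[ℝ] CliffordAlgebra Q →ₗ[ℂ] A :=
  letI : Algebra ℝ A := Algebra.complexToReal
  LinearMap.liftBaseChange ℂ (CliffordAlgebra.lift Q
    ⟨{ toFun := f, map_add' := hadd, map_smul' := hsmul }, hsq⟩).toLinearMap

/-- The symbol isomorphism `𝔍 : Cl(V, g) ⊗ ℂ → ⋀^•(V^* ⊗ ℂ)`: on orthogonal vectors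
`𝔍(e₁ ⋯ eₚ) = g(e₁) ∧ ⋯ ∧ g(eₚ)`. -/
def symbolMap : ℂ ⊗[ℝ] CliffordAlgebra (metricForm V) →ₗ[ℂ] Forms V :=
  letI : Invertible (2 : ℝ) := invertibleOfNonzero two_ne_zero
  (complexLift (0 : QuadraticForm ℝ V) (fun v => ExteriorAlgebra.ι ℂ (cplx (flat v)))
      (fun v w => by simp only [map_add])
      (fun r v => by
        have h : cplx (flat (r • v)) = (r : ℂ) • cplx (flat v) := by ext w; simp [cplx]
        rw [h, map_smul])
      (fun v => by simp)) ∘ₗ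
    (CliffordAlgebra.equivExterior (metricForm V)).toLinearMap.baseChange ℂ

/-! ### Orthogonal complex structures and their spinors -/

variable (V) in
/-- A complex structure on `V` compatible with the metric. -/
structure OrthComplexStructure where
  J : V →ₗ[ℝ] V
  sq : ∀ v, J (J v) = -v
  orth : ∀ v w, ⟪J v, J w⟫ = ⟪v, w⟫

namespace OrthComplexStructure

variable (𝒥 : OrthComplexStructure V)

/-- `V^*_{1,0}`: the complex covectors with `ξ ∘ J = i ξ`. -/
def forms10 : Submodule ℂ (V →ₗ[ℝ] ℂ) where
  carrier := {ξ | ∀ v, ξ (𝒥.J v) = Complex.I * ξ v}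
  add_mem' {ξ η} hξ hη v := by simp [hξ v, hη v, mul_add]
  zero_mem' v := by simp
  smul_mem' c ξ hξ v := by simp [hξ v, mul_left_comm]

/-- `V^*_{0,1}`: the complex covectors with `ξ ∘ J = -i ξ`. -/
def forms01 : Submodule ℂ (V →ₗ[ℝ] ℂ) where
  carrier := {ξ | ∀ v, ξ (𝒥.J v) = -Complex.I * ξ v}
  add_mem' {ξ η} hξ hη v := by simp [hξ v, hη v, mul_add]
  zero_mem' v := by simp
  smul_mem' c ξ hξ v := by simp [hξ v, mul_left_comm]

/-- The fibre `K = ⋀ⁿ V^*_{1,0}` of the canonical line bundle. -/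
abbrev canonicalLine (n : ℕ) : Submodule ℂ (ExteriorAlgebra ℂ 𝒥.forms10) :=
  ⋀[ℂ]^n 𝒥.forms10

/-- The spinor space `⋀^• V^*_{0,1} ⊗ L`, where `L` is a square root `K^{1/2}` of `K`. -/
abbrev Spinor (L : Type*) [AddCommGroup L] [Module ℂ L] : Type _ :=
  ExteriorAlgebra ℂ 𝒥.forms01 ⊗[ℂ] L

theorem inner_J_left (v w : V) : ⟪𝒥.J v, w⟫ = -⟪v, 𝒥.J w⟫ := by
  have h := 𝒥.orth v (𝒥.J w)
  rw [𝒥.sq, inner_neg_right] at h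
  linarith

/-- The `(0,1)`-covector `g(v^{1,0})`, where `v^{1,0} = (v - i J v) / 2` and `g` is extended
complex-bilinearly. -/
def flat01 (v : V) : 𝒥.forms01 :=
  ⟨(1 / 2 : ℂ) • (cplx (flat v) - Complex.I • cplx (flat (𝒥.J v))), fun w => by
    have h1 : ⟪𝒥.J v, w⟫ = -⟪v, 𝒥.J w⟫ := 𝒥.inner_J_left v w
    have h2 := 𝒥.orth v w
    simp only [cplx, flat, LinearMap.smul_apply, LinearMap.sub_apply, LinearMap.compRight_apply,
      LinearMap.comp_apply, innerₗ_apply_apply, Algebra.linearMap_apply, smul_eq_mul,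
      Complex.coe_algebraMap, h1, h2]
    push_cast
    linear_combination (1 / 2 : ℂ) * (⟪v, 𝒥.J w⟫ : ℂ) * Complex.I_mul_I⟩

theorem flat01_add (v w : V) : 𝒥.flat01 (v + w) = 𝒥.flat01 v + 𝒥.flat01 w := by
  apply Subtype.ext
  simp only [flat01, map_add, Submodule.coe_add, smul_add, smul_sub]
  abel

theorem flat01_smul (r : ℝ) (v : V) : 𝒥.flat01 (r • v) = (r : ℂ) • 𝒥.flat01 v := by
  apply Subtype.ext
  ext w
  simp [flat01, cplx, flat]
  ring

theorem flat01_apply_self (v : V) : (𝒥.flat01 v : V →ₗ[ℝ] ℂ) v = (1 / 2 : ℂ) * (⟪v, v⟫ : ℝ) := by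
  have h : ⟪𝒥.J v, v⟫ = (0 : ℝ) := by
    have := 𝒥.inner_J_left v v
    rw [real_inner_comm v (𝒥.J v)] at this
    linarith [real_inner_comm v (𝒥.J v)]
  simp [flat01, cplx, flat, h]

/-- Clifford multiplication by a real vector on `⋀^• V^*_{0,1}`:
`v · α = √2 (ι_{v^{0,1}} α + g(v^{1,0}) ∧ α)`. As `(0,1)`-covectors vanish on `v^{1,0}`, contraction
with `v^{0,1}` is contraction with `v`. For a unitary basis `(fᵢ)` of `V^{1,0}` the complex-linear
extension maps `f̄ᵢ` to `√2 ι_{f̄ᵢ}` and `fᵢ` to `√2 f̄ⁱ ∧`. -/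
def clif₀ (v : V) : Module.End ℂ (ExteriorAlgebra ℂ 𝒥.forms01) :=
  ((Real.sqrt 2 : ℝ) : ℂ) •
    (CliffordAlgebra.contractLeft (Q := (0 : QuadraticForm ℂ 𝒥.forms01))
        ((evalAt v).comp 𝒥.forms01.subtype)
      + LinearMap.mulLeft ℂ (ExteriorAlgebra.ι ℂ (𝒥.flat01 v)))

theorem clif₀_add (v w : V) : 𝒥.clif₀ (v + w) = 𝒥.clif₀ v + 𝒥.clif₀ w := by
  refine LinearMap.ext fun α => ?_
  simp only [clif₀, flat01_add, map_add, LinearMap.add_comp, LinearMap.add_apply,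
    LinearMap.smul_apply, LinearMap.mulLeft_apply, add_mul, smul_add]
  abel

theorem clif₀_smul (r : ℝ) (v : V) : 𝒥.clif₀ (r • v) = (r : ℂ) • 𝒥.clif₀ v := by
  have h : (evalAt (r • v)).comp 𝒥.forms01.subtype
      = (r : ℂ) • (evalAt v).comp 𝒥.forms01.subtype := by
    ext ξ; simp [evalAt]
  refine LinearMap.ext fun α => ?_
  rw [clif₀, h]
  simp only [clif₀, flat01_smul, map_smul, LinearMap.add_apply, LinearMap.smul_apply,
    LinearMap.mulLeft_apply, smul_mul_assoc, ← smul_add]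
  rw [smul_comm]

theorem clif₀_sq (v : V) (α : ExteriorAlgebra ℂ 𝒥.forms01) :
    𝒥.clif₀ v (𝒥.clif₀ v α) = ((⟪v, v⟫ : ℝ) : ℂ) • α := by
  have h2 : ((Real.sqrt 2 : ℝ) : ℂ) * ((Real.sqrt 2 : ℝ) : ℂ) = 2 := by
    rw [← Complex.ofReal_mul, Real.mul_self_sqrt (by norm_num)]; simp
  have hv : ((evalAt v).comp 𝒥.forms01.subtype) (𝒥.flat01 v) = (1 / 2 : ℂ) * (⟪v, v⟫ : ℝ) :=
    𝒥.flat01_apply_self v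
  have hι : ExteriorAlgebra.ι ℂ (𝒥.flat01 v) * (ExteriorAlgebra.ι ℂ (𝒥.flat01 v) * α) = 0 := by
    rw [← mul_assoc, ExteriorAlgebra.ι_sq_zero, zero_mul]
  have hc := CliffordAlgebra.contractLeft_ι_mul (Q := (0 : QuadraticForm ℂ 𝒥.forms01))
    (d := (evalAt v).comp 𝒥.forms01.subtype) (𝒥.flat01 v) α
  have hcc := CliffordAlgebra.contractLeft_contractLeft (Q := (0 : QuadraticForm ℂ 𝒥.forms01))
    (d := (evalAt v).comp 𝒥.forms01.subtype) α
  simp only [clif₀, LinearMap.smul_apply, LinearMap.add_apply, LinearMap.mulLeft_apply, map_smul,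
    map_add, smul_add, smul_smul, h2]
  rw [hι, hcc, show CliffordAlgebra.contractLeft (Q := (0 : QuadraticForm ℂ 𝒥.forms01))
    ((evalAt v).comp 𝒥.forms01.subtype) (ExteriorAlgebra.ι ℂ (𝒥.flat01 v) * α) = _ from hc, hv]
  simp only [smul_sub, smul_smul, smul_zero, zero_add, add_zero]
  rw [show (2 : ℂ) * (1 / 2 * (⟪v, v⟫ : ℝ)) = (⟪v, v⟫ : ℝ) by ring]
  exact add_sub_cancel _ _

variable (L : Type*) [AddCommGroup L] [Module ℂ L]

/-- Clifford multiplication by a real vector on spinors. -/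
def clif (v : V) : Module.End ℂ (𝒥.Spinor L) := (𝒥.clif₀ v).rTensor L

/-- The spinor representation `ρ : Cl(V, g) ⊗ ℂ → End(S)`. -/
def spinRep : ℂ ⊗[ℝ] CliffordAlgebra (metricForm V) →ₗ[ℂ] Module.End ℂ (𝒥.Spinor L) :=
  complexLift (metricForm V) (𝒥.clif L)
    (fun v w => by simp only [clif, clif₀_add, LinearMap.rTensor_add])
    (fun r v => by simp only [clif, clif₀_smul, LinearMap.rTensor_smul])
    (fun v => by
      refine TensorProduct.ext' fun α s => ?_
      simp only [clif, Module.End.mul_apply, LinearMap.rTensor_tmul, clif₀_sq,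
        Module.algebraMap_end_apply, TensorProduct.smul_tmul']
      rfl)

/-- The Spin-invariant bilinear pairing
`q(α ⊗ s, β ⊗ t) = (μ(α) ∧ β)_top / conj(s₀²)`, rescaled by `s t / s₀²`, for a unit vector `s₀` of
`L = K^{1/2}`. Here `μ` reverses the order of products and `sq : L ⊗ L ≅ K` is the squaring map.
As `s₀²` is a unit vector of the line `K` of `(n,0)`-forms, dividing the `(0,n)`-form
`(μ(α) ∧ β)_top` by `conj(s₀²)` is the same as pairing it complex-bilinearly with `s₀²`; so the
value is the complex-bilinear metric pairing `(1/n!) ∑ κ(e_{I₁},…,e_{Iₙ}) λ(e_{I₁},…,e_{Iₙ})` of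
`κ = s t` and `λ = (μ(α) ∧ β)_top`, over all `n`-tuples from an orthonormal basis `(eᵢ)`. -/
def spinPairing [FiniteDimensional ℝ V] {n : ℕ} (sq : L ⊗[ℂ] L ≃ₗ[ℂ] 𝒥.canonicalLine n) :
    LinearMap.BilinForm ℂ (𝒥.Spinor L) :=
  (1 / (n.factorial : ℂ)) • ∑ I : Fin n → Fin (finrank ℝ V),
    LinearMap.BilinForm.tmul
      (((LinearMap.mul ℂ (ExteriorAlgebra ℂ 𝒥.forms01)).comp CliffordAlgebra.reverse).compr₂
        (evalForm 𝒥.forms01 fun j => stdOrthonormalBasis ℝ V (I j)))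
      ((TensorProduct.mk ℂ L L).compr₂
        ((evalForm 𝒥.forms10 fun j => stdOrthonormalBasis ℝ V (I j)).comp
          ((𝒥.canonicalLine n).subtype.comp sq.toLinearMap)))

/-- `q^♯ : S ⊗ S → End(S)`, `q^♯(φ ⊗ ψ)(χ) = q(ψ, χ) φ`. -/
def qSharp [FiniteDimensional ℝ V] {n : ℕ} (sq : L ⊗[ℂ] L ≃ₗ[ℂ] 𝒥.canonicalLine n) :
    𝒥.Spinor L ⊗[ℂ] 𝒥.Spinor L →ₗ[ℂ] Module.End ℂ (𝒥.Spinor L) :=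
  TensorProduct.lift (LinearMap.mk₂ ℂ (fun φ ψ => (𝒥.spinPairing L sq ψ).smulRight φ)
    (fun φ φ' ψ => LinearMap.ext fun χ => by
      simp only [LinearMap.smulRight_apply, LinearMap.add_apply, smul_add])
    (fun c φ ψ => LinearMap.ext fun χ => by
      simp only [LinearMap.smulRight_apply, LinearMap.smul_apply, smul_comm c])
    (fun φ ψ ψ' => LinearMap.ext fun χ => by
      simp only [LinearMap.smulRight_apply, LinearMap.add_apply, map_add, add_smul])
    (fun c φ ψ => LinearMap.ext fun χ => by
      simp only [LinearMap.smulRight_apply, LinearMap.smul_apply, map_smul, smul_assoc]))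

/-- The line `K^{1/2} = ⋀⁰ V^*_{0,1} ⊗ K^{1/2} ⊂ S`. -/
def vacuum : L →ₗ[ℂ] 𝒥.Spinor L := TensorProduct.mk ℂ _ L 1

end OrthComplexStructure

/-- The inverse of a linear map; by convention it is zero if the map is not bijective. -/
def linInv {A B : Type*} [AddCommMonoid A] [Module ℂ A] [AddCommMonoid B] [Module ℂ B]
    (f : A →ₗ[ℂ] B) : B →ₗ[ℂ] A :=
  open Classical in
  if h : Function.Bijective f then (LinearEquiv.ofBijective f h).symm.toLinearMap else 0

/-- `q^♭ : S₁ ⊗ S₂ → ⋀^•(V^* ⊗ ℂ)`, the composition of `id ⊗ p`, `q^♯`, `ρ⁻¹` and the symbol map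
`𝔍`, for the spinor spaces `S₁`, `S₂` of two orthogonal complex structures and `p : S₂ ≅ S₁`. -/
def qFlat [FiniteDimensional ℝ V] {n : ℕ} (𝒥₁ 𝒥₂ : OrthComplexStructure V)
    (L₁ L₂ : Type*) [AddCommGroup L₁] [Module ℂ L₁] [AddCommGroup L₂] [Module ℂ L₂]
    (sq : L₁ ⊗[ℂ] L₁ ≃ₗ[ℂ] 𝒥₁.canonicalLine n) (p : 𝒥₂.Spinor L₂ ≃ₗ[ℂ] 𝒥₁.Spinor L₁) :
    𝒥₁.Spinor L₁ ⊗[ℂ] 𝒥₂.Spinor L₂ →ₗ[ℂ] Forms V :=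
  symbolMap ∘ₗ linInv (𝒥₁.spinRep L₁) ∘ₗ 𝒥₁.qSharp L₁ sq
    ∘ₗ TensorProduct.map LinearMap.id p.toLinearMap

/-! ### Generalized Kähler structures at a point -/

variable (V) in
/-- The pointwise part of a generalized Kähler structure on `V ⊕ V^*` in the metric splitting: a
pair of commuting complex structures, orthogonal for the pairing, such that `𝒢 = -𝕁₁ 𝕁₂` is the
generalized metric of `g`, i.e. `𝒢(X + ξ) = g⁻¹ ξ + g X`. -/
structure GKFibre where
  J₁ : GTan V →ₗ[ℝ] GTan V
  J₂ : GTan V →ₗ[ℝ] GTan V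
  sq₁ : ∀ A, J₁ (J₁ A) = -A
  sq₂ : ∀ A, J₂ (J₂ A) = -A
  orth₁ : ∀ A B, pairing (J₁ A) (J₁ B) = pairing A B
  orth₂ : ∀ A B, pairing (J₂ A) (J₂ B) = pairing A B
  comm : ∀ A, J₁ (J₂ A) = J₂ (J₁ A)
  metric_fst : ∀ A, flat (-J₁ (J₂ A)).1 = A.2
  metric_snd : ∀ A, (-J₁ (J₂ A)).2 = flat A.1

namespace GKFibre

variable (G : GKFibre V)

/-- `𝕁₁` preserves the graphs of `± g`, the `± 1`-eigenspaces of `𝒢`. -/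
theorem J₁_graph (ε : ℝ) (hε : ε * ε = 1) (X : V) :
    G.J₁ (X, ε • flat X) = ((G.J₁ (X, ε • flat X)).1, ε • flat (G.J₁ (X, ε • flat X)).1) := by
  set A : GTan V := (X, ε • flat X) with hA
  have inj : Function.Injective (flat : V → Dual ℝ V) := fun v w h => by
    refine ext_inner_right ℝ fun z => ?_
    exact congrArg (fun f : Dual ℝ V => f z) h
  have hG : -G.J₁ (G.J₂ A) = ε • A := by
    refine Prod.ext (inj ?_) ?_
    · rw [G.metric_fst, hA, Prod.smul_fst, map_smul]
    · rw [G.metric_snd, hA, Prod.smul_snd, smul_smul, hε, one_smul]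
  have h : -G.J₁ (G.J₂ (G.J₁ A)) = ε • G.J₁ A := by
    rw [← G.comm, ← map_neg, hG, map_smul]
  refine Prod.ext rfl ?_
  have h1 := G.metric_fst (G.J₁ A)
  rw [h, Prod.smul_fst, map_smul] at h1
  exact h1.symm

/-- For `ε = ± 1`, the complex structure `J` of `V` with `𝕁₁(X + ε g X) = -(J X + ε g(J X))`. -/
def Jsign (ε : ℝ) (hε : ε * ε = 1) : OrthComplexStructure V where
  J := -(LinearMap.fst ℝ V (Dual ℝ V) ∘ₗ G.J₁ ∘ₗ LinearMap.prod LinearMap.id (ε • flat))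
  sq v := by
    have h := G.J₁_graph ε hε v
    have h2 := G.sq₁ (v, ε • flat v)
    rw [h] at h2
    have h4 := congrArg Prod.fst h2
    simp only [LinearMap.neg_apply, LinearMap.comp_apply, LinearMap.prod_apply,
      LinearMap.fst_apply, map_neg, neg_neg]
    exact h4
  orth v w := by
    have h := G.orth₁ (v, ε • flat v) (w, ε • flat w)
    rw [G.J₁_graph ε hε v, G.J₁_graph ε hε w] at h
    simp only [pairing, flat, LinearMap.smul_apply, innerₗ_apply_apply, smul_eq_mul] at h
    rw [real_inner_comm v w, real_inner_comm (G.J₁ (v, ε • innerₗ V v)).1] at h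
    have hε0 : ε ≠ 0 := fun h0 => by simp [h0] at hε
    have : ε * ⟪(G.J₁ (v, ε • innerₗ V v)).1, (G.J₁ (w, ε • innerₗ V w)).1⟫ = ε * ⟪v, w⟫ := by
      linarith
    simpa [flat] using mul_left_cancel₀ hε0 this

/-- The complex structure `J₊`. -/
def Jplus : OrthComplexStructure V := G.Jsign 1 (by norm_num)

/-- The complex structure `J₋`. -/
def Jminus : OrthComplexStructure V := G.Jsign (-1) (by norm_num)

/-- `U_{k,l}`: the common eigenspace in `⋀^•(V^* ⊗ ℂ)` of the spin lifts of `𝕁₁` and `𝕁₂` for the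
eigenvalues `k i` and `l i`. -/
def U [FiniteDimensional ℝ V] (k l : ℤ) : Submodule ℂ (Forms V) :=
  Module.End.eigenspace (spinLift G.J₁) (k * Complex.I)
    ⊓ Module.End.eigenspace (spinLift G.J₂) (l * Complex.I)

end GKFibre

end Fibre

/-! ## Generalized Kähler manifolds of real dimension `2n` -/

section Manifold

variable {n : ℕ} {M : Type*} [TopologicalSpace M]
  [ChartedSpace (EuclideanSpace ℝ (Fin (2 * n))) M] [IsManifold (𝓡 (2 * n)) ∞ M]

instance (x : M) : FiniteDimensional ℝ (TangentSpace (𝓡 (2 * n)) x) :=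
  inferInstanceAs (FiniteDimensional ℝ (EuclideanSpace ℝ (Fin (2 * n))))

variable (n M) in
/-- Not necessarily smooth vector fields; only their values on an open set `U` will matter. -/
abbrev VField : Type _ := ∀ x : M, TangentSpace (𝓡 (2 * n)) x

/-- The vector field `X` is smooth on `U`. -/
def SmoothVF (X : VField n M) (U : Set M) : Prop :=
  ContMDiffOn (𝓡 (2 * n)) (𝓡 (2 * n)).tangent ∞
    (fun x => (⟨x, X x⟩ : TangentBundle (𝓡 (2 * n)) M)) U

/-- The function `f` is smooth on `U`. -/
def SmoothFun (n : ℕ) {M : Type*} [TopologicalSpace M]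
    [ChartedSpace (EuclideanSpace ℝ (Fin (2 * n))) M] (f : M → ℝ) (U : Set M) : Prop :=
  ContMDiffOn (𝓡 (2 * n)) 𝓘(ℝ, ℝ) ∞ f U

/-- The derivative `X f` at `x`. -/
def dirDeriv (X : VField n M) (f : M → ℝ) (x : M) : ℝ :=
  mfderiv (𝓡 (2 * n)) 𝓘(ℝ, ℝ) f x (X x)

/-- The Lie bracket `[X, Y]`. -/
def lieBr (X Y : VField n M) : VField n M := VectorField.mlieBracket (𝓡 (2 * n)) X Y

variable (n M) in
/-- Fields of alternating 3-forms. -/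
abbrev ThreeForm : Type _ := ∀ x : M, TangentSpace (𝓡 (2 * n)) x [⋀^Fin 3]→ₗ[ℝ] ℝ

/-- The function `H(X, Y, Z)`. -/
def ThreeForm.app (H : ThreeForm n M) (X Y Z : VField n M) (x : M) : ℝ := H x ![X x, Y x, Z x]

/-- The value of `dH(X, Y, Z, W)` at `x`. -/
def ThreeForm.d (H : ThreeForm n M) (X Y Z W : VField n M) (x : M) : ℝ :=
  dirDeriv X (H.app Y Z W) x - dirDeriv Y (H.app X Z W) x
    + dirDeriv Z (H.app X Y W) x - dirDeriv W (H.app X Y Z) x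
    - H.app (lieBr X Y) Z W x + H.app (lieBr X Z) Y W x - H.app (lieBr X W) Y Z x
    - H.app (lieBr Y Z) X W x + H.app (lieBr Y W) X Z x - H.app (lieBr Z W) X Y x

variable [Bundle.RiemannianBundle (fun x : M => TangentSpace (𝓡 (2 * n)) x)]

variable (n M) in
/-- Not necessarily smooth sections of `T ⊕ T^*`. -/
abbrev GSection : Type _ := ∀ x : M, GTan (TangentSpace (𝓡 (2 * n)) x)

/-- The section `X + ξ` of `T ⊕ T^*` is smooth on the open set `U`. -/
def GSection.SmoothOn (A : GSection n M) (U : Set M) : Prop :=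
  SmoothVF (fun x => (A x).1) U ∧
    ∀ (W : Set M) (Y : VField n M), IsOpen W → W ⊆ U → SmoothVF Y W →
      SmoothFun n (fun x => (A x).2 (Y x)) W

/-- `([A, B]_H, C)` at `x` for the `H`-twisted Courant bracket
`[X + ξ, Y + η]_H = [X, Y] + 𝓛_X η - ι_Y dξ + ι_Y ι_X H` and `C = Z + ζ`. It is
`ζ([X, Y]) + (𝓛_X η)(Z) - dξ(Y, Z) + H(X, Y, Z)`, where `(𝓛_X η)(Z) = X(η(Z)) - η([X, Z])` and
`dξ(Y, Z) = Y(ξ(Z)) - Z(ξ(Y)) - ξ([Y, Z])`. -/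
def courant (H : ThreeForm n M) (A B C : GSection n M) (x : M) : ℝ :=
  (C x).2 (lieBr (fun y => (A y).1) (fun y => (B y).1) x)
    + (dirDeriv (fun y => (A y).1) (fun y => (B y).2 (C y).1) x
      - (B x).2 (lieBr (fun y => (A y).1) (fun y => (C y).1) x))
    - (dirDeriv (fun y => (B y).1) (fun y => (A y).2 (C y).1) x
      - dirDeriv (fun y => (C y).1) (fun y => (A y).2 (B y).1) x
      - (A x).2 (lieBr (fun y => (B y).1) (fun y => (C y).1) x))
    + H.app (fun y => (A y).1) (fun y => (B y).1) (fun y => (C y).1) x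

/-- Involutivity of the `i`-eigenbundle `L` of an orthogonal complex structure `𝕁` on `T ⊕ T^*` under
the `H`-twisted Courant bracket. The local sections of `L` are `a = A - i 𝕁 A` with `A` a local
section of `T ⊕ T^*`, and `L` is maximal isotropic; so involutivity means `([a, b]_H, c) = 0` for all
local sections `a`, `b`, `c` of `L`. The condition is the vanishing of the real part; replacing `A`
by `𝕁 A` in it gives the imaginary part. -/
def Involutive (H : ThreeForm n M)
    (𝕁 : ∀ x : M, GTan (TangentSpace (𝓡 (2 * n)) x) →ₗ[ℝ] GTan (TangentSpace (𝓡 (2 * n)) x)) :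
    Prop :=
  ∀ (U : Set M) (A B C : GSection n M), IsOpen U →
    A.SmoothOn U → B.SmoothOn U → C.SmoothOn U → ∀ x ∈ U,
      courant H A B C x
        - courant H (fun y => 𝕁 y (A y)) (fun y => 𝕁 y (B y)) C x
        - courant H (fun y => 𝕁 y (A y)) B (fun y => 𝕁 y (C y)) x
        - courant H A (fun y => 𝕁 y (B y)) (fun y => 𝕁 y (C y)) x = 0

variable (n M) in
/-- A generalized Kähler structure on `M` in its metric splitting: a closed 3-form `H` and a pair
`(𝕁₁, 𝕁₂)` of commuting generalized complex structures on `T ⊕ T^*` with the `H`-twisted Courant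
bracket, such that `-𝕁₁ 𝕁₂` is the generalized metric of the Riemannian metric `g` of `M`. -/
structure GKStructure where
  H : ThreeForm n M
  H_smooth : ∀ (U : Set M) (X Y Z : VField n M), IsOpen U →
    SmoothVF X U → SmoothVF Y U → SmoothVF Z U → SmoothFun n (H.app X Y Z) U
  H_closed : ∀ (U : Set M) (X Y Z W : VField n M), IsOpen U →
    SmoothVF X U → SmoothVF Y U → SmoothVF Z U → SmoothVF W U → ∀ x ∈ U, H.d X Y Z W x = 0
  fibre : ∀ x : M, GKFibre (TangentSpace (𝓡 (2 * n)) x)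
  smooth₁ : ∀ (U : Set M) (A : GSection n M), IsOpen U → A.SmoothOn U →
    GSection.SmoothOn (fun x => (fibre x).J₁ (A x)) U
  smooth₂ : ∀ (U : Set M) (A : GSection n M), IsOpen U → A.SmoothOn U →
    GSection.SmoothOn (fun x => (fibre x).J₂ (A x)) U
  involutive₁ : Involutive H fun x => (fibre x).J₁
  involutive₂ : Involutive H fun x => (fibre x).J₂

/-- The complex structure `J₊` on `M`. -/
def GKStructure.Jp (𝒢 : GKStructure n M) (x : M) :
    OrthComplexStructure (TangentSpace (𝓡 (2 * n)) x) := (𝒢.fibre x).Jplus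

/-- The complex structure `J₋` on `M`. -/
def GKStructure.Jm (𝒢 : GKStructure n M) (x : M) :
    OrthComplexStructure (TangentSpace (𝓡 (2 * n)) x) := (𝒢.fibre x).Jminus

end Manifold

end GenKahler

/-! Under `q^♭` the graph of `g` acts on the first spinor and, in products of two, the graph of `-g`
acts on the second. Indeed the symbol map turns left Clifford multiplication by `v` into the action
of `v + g v`, and right multiplication by `v`, up to sign and the parity involution, into the action
of `v - g v`. Left multiplication of `q^♯(φ ⊗ ψ)` multiplies `φ`. Since Clifford multiplication is
symmetric for `q`, right multiplication multiplies `ψ`, and the equivariance of `p` carries this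
back to `S₂`. This is `gact_graphPlus_qFlat` and `gact_graphMinus_qFlat`.

Both graphs are preserved by `𝕁₁` and `𝕁₂`, which agree on the graph of `g` and are opposite on the
graph of `-g`. So the two spin lifts are `P + Q` and `P - Q`, where `P` comes from the first graph
and `Q` from the second. Through `q^♭`, `P` is the spin lift of `-J₊` on `S₁` and `Q` that of `-J₋`
on `S₂`, and each equals `i (n/2 - degree)` (`sum_lie_clif₀_J`). The eigenvalues `n i` and `0`
therefore say that both degrees vanish, which singles out the product of the vacuum lines
(`mem_range_map_iff`).

Bijectivity rests on irreducibility of the spinors under Clifford multiplication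
(`clif₀_irreducible`). By Burnside's theorem `ρ` is then onto, and dimensions agree. The kernel of
`q` is Clifford-invariant and `q ≠ 0`, so `q` is nondegenerate and `q^♯` is bijective. The symbol
map is bijective by surjectivity and dimension. -/

namespace GenKahler

/-! ### Exterior algebra: degree operator, irreducibility, integration by parts. -/

section ExteriorNumberOperator

variable {K : Type*} [Field K] {W : Type*} [AddCommGroup W] [Module K W]

/-- Contraction of an exterior form with a covector. -/
abbrev ctr (d : Dual K W) : Module.End K (ExteriorAlgebra K W) :=
  CliffordAlgebra.contractLeft (Q := (0 : QuadraticForm K W)) d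

/-- Exterior multiplication by a vector. -/
abbrev wdg (u : W) : Module.End K (ExteriorAlgebra K W) :=
  LinearMap.mulLeft K (ExteriorAlgebra.ι K u)

theorem ctr_wdg (d : Dual K W) (u : W) (α : ExteriorAlgebra K W) :
    ctr d (wdg u α) = d u • α - wdg u (ctr d α) :=
  CliffordAlgebra.contractLeft_ι_mul (Q := (0 : QuadraticForm K W)) (d := d) u α

theorem wdg_wdg (u v : W) (α : ExteriorAlgebra K W) : wdg u (wdg v α) = -wdg v (wdg u α) := by
  have h := ExteriorAlgebra.ι_add_mul_swap (R := K) u v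
  simp only [LinearMap.mulLeft_apply, ← mul_assoc, eq_neg_of_add_eq_zero_left h, neg_mul]

theorem ctr_ctr (d d' : Dual K W) (α : ExteriorAlgebra K W) :
    ctr d (ctr d' α) = -ctr d' (ctr d α) :=
  CliffordAlgebra.contractLeft_comm (Q := (0 : QuadraticForm K W)) d d' α

theorem finrank_exteriorAlgebra [FiniteDimensional K W] :
    finrank K (ExteriorAlgebra K W) = 2 ^ finrank K W := by
  rw [finrank_eq_card_basis (Module.finBasis K W).ExteriorAlgebra, Fintype.card_finset,
    Fintype.card_fin]

instance finiteDimensional_exteriorAlgebra [FiniteDimensional K W] :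
    FiniteDimensional K (ExteriorAlgebra K W) :=
  (Module.finBasis K W).ExteriorAlgebra.finiteDimensional_of_finite

variable {I : Type*} [Fintype I] (u : I → W) (d : I → Dual K W)

/-- The operator `∑ uᵢ ∧ ι_{dᵢ}`, which is the degree operator if `∑ dᵢ ⊗ uᵢ` is the identity. -/
def numberOp : Module.End K (ExteriorAlgebra K W) := ∑ i, wdg (u i) ∘ₗ ctr (d i)

theorem numberOp_apply (α : ExteriorAlgebra K W) :
    numberOp u d α = ∑ i, wdg (u i) (ctr (d i) α) := by
  simp [numberOp]

variable {u d}

/-- Each `uᵢ ∧ ι_{dᵢ}` is a derivation, as the two signs from passing `ξ` cancel. The family only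
has to resolve the identity and need not be a basis: it will consist of `2n` covectors in an
`n`-dimensional space. -/
theorem numberOp_ι_mul (h : ∀ ξ, ∑ i, d i ξ • u i = ξ) (ξ : W) (α : ExteriorAlgebra K W) :
    numberOp u d (ExteriorAlgebra.ι K ξ * α)
      = ExteriorAlgebra.ι K ξ * α + ExteriorAlgebra.ι K ξ * numberOp u d α := by
  change numberOp u d (wdg ξ α) = wdg ξ α + wdg ξ (numberOp u d α)
  have h1 : ∀ i, wdg (u i) (ctr (d i) (wdg ξ α))
      = d i ξ • wdg (u i) α + wdg ξ (wdg (u i) (ctr (d i) α)) := fun i => by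
    rw [ctr_wdg, map_sub, map_smul, wdg_wdg (u i) ξ, sub_neg_eq_add]
  simp only [numberOp_apply, h1, Finset.sum_add_distrib, map_sum]
  congr 1
  conv_rhs => rw [← h ξ]
  simp only [LinearMap.mulLeft_apply, map_sum, map_smul, Finset.sum_mul, smul_mul_assoc]

theorem numberOp_of_mem (h : ∀ ξ, ∑ i, d i ξ • u i = ξ) {k : ℕ} {α : ExteriorAlgebra K W}
    (hα : α ∈ ⋀[K]^k W) : numberOp u d α = (k : K) • α := by
  induction hα using Submodule.pow_induction_on_left' with
  | algebraMap r => simp [numberOp_apply, CliffordAlgebra.contractLeft_algebraMap]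
  | add x y i hx hy ihx ihy => rw [map_add, ihx, ihy, smul_add]
  | mem_mul m hm i x hx ih =>
    obtain ⟨ξ, rfl⟩ := hm
    rw [numberOp_ι_mul h, ih, mul_smul_comm, Nat.cast_succ, add_smul, one_smul, add_comm]

theorem decompose_numberOp (h : ∀ ξ, ∑ i, d i ξ • u i = ξ) (α : ExteriorAlgebra K W) (k : ℕ) :
    (DirectSum.decompose (fun i : ℕ => ⋀[K]^i W) (numberOp u d α) k : ExteriorAlgebra K W)
      = (k : K) • (DirectSum.decompose (fun i : ℕ => ⋀[K]^i W) α k : ExteriorAlgebra K W) := by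
  classical
  induction α using DirectSum.Decomposition.inductionOn (fun i : ℕ => ⋀[K]^i W) with
  | zero => simp
  | @homogeneous i m =>
    rw [numberOp_of_mem h m.2, DirectSum.decompose_smul, DirectSum.decompose_coe]
    rw [DirectSum.smul_apply, Submodule.coe_smul]
    by_cases hik : i = k
    · subst hik; rfl
    · rw [DirectSum.of_eq_of_ne _ _ _ (Ne.symm hik)]; simp
  | add x y hx hy =>
    simp only [map_add, DirectSum.decompose_add, DirectSum.add_apply, Submodule.coe_add, hx, hy,
      smul_add]

/-- A nonzero eigenvector of the degree operator is homogeneous. -/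
theorem exists_mem_of_numberOp_eq [CharZero K] (h : ∀ ξ, ∑ i, d i ξ • u i = ξ) {c : K}
    {α : ExteriorAlgebra K W} (hα : α ≠ 0) (hc : numberOp u d α = c • α) :
    ∃ k : ℕ, c = k ∧ α ∈ ⋀[K]^k W := by
  classical
  have key : ∀ k : ℕ, (c - k) •
      (DirectSum.decompose (fun i : ℕ => ⋀[K]^i W) α k : ExteriorAlgebra K W) = 0 := fun k => by
    have := decompose_numberOp h α k
    rw [hc, DirectSum.decompose_smul, DirectSum.smul_apply, Submodule.coe_smul] at this
    rw [sub_smul, this, sub_self]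
  have hsum := DirectSum.sum_support_decompose (fun i : ℕ => ⋀[K]^i W) α
  have hex : ∃ k : ℕ,
      (DirectSum.decompose (fun i : ℕ => ⋀[K]^i W) α k : ExteriorAlgebra K W) ≠ 0 := by
    by_contra! hcon
    exact hα (by rw [← hsum]; exact Finset.sum_eq_zero fun i _ => hcon i)
  obtain ⟨k, hk⟩ := hex
  have hck : c = k := by
    rcases smul_eq_zero.1 (key k) with h0 | h0
    · exact sub_eq_zero.1 h0
    · exact absurd h0 hk
  refine ⟨k, hck, ?_⟩
  have hz : ∀ j : ℕ, j ≠ k →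
      (DirectSum.decompose (fun i : ℕ => ⋀[K]^i W) α j : ExteriorAlgebra K W) = 0 := by
    intro j hj
    rcases smul_eq_zero.1 (key j) with h0 | h0
    · rw [hck, sub_eq_zero, Nat.cast_inj] at h0
      exact absurd h0.symm hj
    · exact h0
  rw [← hsum]
  refine Submodule.sum_mem _ fun j _ => ?_
  by_cases hj : j = k
  · subst hj; exact Subtype.property _
  · rw [hz j hj]; exact Submodule.zero_mem _

/-- The dual resolution `∑ e(uᵢ) dᵢ = e` collapses the commutator to one contraction. This is how
contraction is seen to lower the degree. -/
theorem numberOp_ctr (h : ∀ ξ, ∑ i, d i ξ • u i = ξ) (e : Dual K W) (α : ExteriorAlgebra K W) :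
    numberOp u d (ctr e α) = ctr e (numberOp u d α) - ctr e α := by
  have hd : ∑ i, e (u i) • d i = e := by
    ext ξ
    conv_rhs => rw [← h ξ]
    simp [mul_comm]
  have h2 : ctr e α = ∑ i, e (u i) • ctr (d i) α := by
    conv_lhs => rw [← hd]
    simp [map_sum]
  simp only [numberOp_apply, map_sum, ctr_wdg, Finset.sum_sub_distrib]
  rw [← h2, sub_sub_cancel_left, ← Finset.sum_neg_distrib]
  exact Finset.sum_congr rfl fun i _ => by rw [ctr_ctr, map_neg]

theorem ker_numberOp [CharZero K] (h : ∀ ξ, ∑ i, d i ξ • u i = ξ) :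
    LinearMap.ker (numberOp u d) = LinearMap.range (Algebra.linearMap K (ExteriorAlgebra K W)) := by
  ext α
  constructor
  · intro hα
    by_cases h0 : α = 0
    · rw [h0]; exact Submodule.zero_mem _
    obtain ⟨k, hk, hmem⟩ := exists_mem_of_numberOp_eq h h0 (c := 0) (by simpa using hα)
    obtain rfl : k = 0 := by exact_mod_cast hk.symm
    rw [← Submodule.one_eq_range]
    simpa using hmem
  · rintro ⟨r, rfl⟩
    simp [numberOp_apply, CliffordAlgebra.contractLeft_algebraMap]

theorem eq_top_of_one_mem {N : Submodule K (ExteriorAlgebra K W)} (h1 : (1 : ExteriorAlgebra K W) ∈ N)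
    (hw : ∀ (w : W), ∀ α ∈ N, wdg w α ∈ N) : N = ⊤ := by
  refine eq_top_iff.2 fun α _ => ?_
  induction α using CliffordAlgebra.left_induction with
  | algebraMap r => rw [Algebra.algebraMap_eq_smul_one]; exact N.smul_mem _ h1
  | add x y hx hy => exact N.add_mem (hx trivial) (hy trivial)
  | ι_mul x m hx => exact hw m x (hx trivial)

/-- The exterior algebra is irreducible under exterior multiplications and contractions. -/
theorem eq_bot_or_eq_top [CharZero K] [IsAlgClosed K] [FiniteDimensional K W]
    {N : Submodule K (ExteriorAlgebra K W)} (hc : ∀ (e : Dual K W), ∀ α ∈ N, ctr e α ∈ N)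
    (hw : ∀ (w : W), ∀ α ∈ N, wdg w α ∈ N) : N = ⊥ ∨ N = ⊤ := by
  classical
  by_cases hN : N = ⊥
  · exact Or.inl hN
  right
  let b := Module.finBasis K W
  have h : ∀ ξ, ∑ i, b.coord i ξ • b i = ξ := fun ξ => b.sum_repr ξ
  set D := numberOp (⇑b) b.coord with hD
  have hDN : ∀ α ∈ N, D α ∈ N := fun α hα => by
    rw [hD, numberOp_apply]
    exact N.sum_mem fun i _ => hw _ _ (hc _ _ hα)
  have hnt : Nontrivial N := Submodule.nontrivial_iff_ne_bot.2 hN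
  have hex : ∃ k : ℕ, ∃ α ∈ N, α ≠ 0 ∧ D α = (k : K) • α := by
    obtain ⟨c, hce⟩ := Module.End.exists_eigenvalue (D.restrict hDN)
    obtain ⟨v, hv⟩ := hce.exists_hasEigenvector
    have hv1 : D v = c • (v : ExteriorAlgebra K W) := congrArg Subtype.val hv.apply_eq_smul
    have hv2 : (v : ExteriorAlgebra K W) ≠ 0 := fun h0 => hv.2 (Subtype.ext h0)
    obtain ⟨k, rfl, -⟩ := exists_mem_of_numberOp_eq h hv2 hv1
    exact ⟨k, v, v.2, hv2, hv1⟩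
  -- An eigenvector in `N` of least degree: a nonzero contraction of it would have smaller degree,
  -- so all contractions kill it, hence so does `D`, and its degree is zero. Thus `N` contains a
  -- nonzero scalar.
  obtain ⟨α, hα, hα0, hαk⟩ := Nat.find_spec hex
  rcases hk : Nat.find hex with _ | k
  · rw [hk, Nat.cast_zero, zero_smul] at hαk
    have hm : α ∈ LinearMap.ker D := hαk
    rw [hD, ker_numberOp h] at hm
    obtain ⟨r, rfl⟩ := hm
    have hr : r ≠ 0 := fun h0 => hα0 (by rw [h0, map_zero])
    refine eq_top_of_one_mem ?_ hw
    have := N.smul_mem r⁻¹ hα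
    rwa [Algebra.linearMap_apply, Algebra.algebraMap_eq_smul_one, smul_smul, inv_mul_cancel₀ hr,
      one_smul] at this
  · exfalso
    rw [hk] at hαk
    have hz : ∀ e, ctr e α = 0 := fun e => by
      by_contra hne
      refine Nat.find_min hex (m := k) (by omega) ⟨ctr e α, hc e α hα, hne, ?_⟩
      rw [hD, numberOp_ctr h, ← hD, hαk, map_smul, Nat.cast_succ, add_smul, one_smul,
        add_sub_cancel_right]
    have : D α = 0 := by simp [hD, numberOp_apply, hz]
    rw [this] at hαk
    rcases smul_eq_zero.1 hαk.symm with h0 | h0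
    · exact absurd h0 (by exact_mod_cast Nat.succ_ne_zero k)
    · exact hα0 h0

theorem eq_zero_of_mem_exteriorPower [FiniteDimensional K W] {k : ℕ} (hk : finrank K W < k)
    {α : ExteriorAlgebra K W} (hα : α ∈ ⋀[K]^k W) : α = 0 := by
  have h0 : finrank K (⋀[K]^k W) = 0 := by
    rw [exteriorPower.finrank_eq, Nat.choose_eq_zero_of_lt hk]
  have : Subsingleton (⋀[K]^k W) := finrank_zero_iff.1 h0
  exact congrArg Subtype.val (Subsingleton.elim (⟨α, hα⟩ : ⋀[K]^k W) 0)

/-- By `numberOp_ctr` the contraction is an eigenvector of the degree operator for `k`, and nonzero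
eigenvectors are homogeneous. -/
theorem ctr_mem_exteriorPower [CharZero K] [FiniteDimensional K W] (e : Dual K W) {k : ℕ}
    {α : ExteriorAlgebra K W} (hα : α ∈ ⋀[K]^(k + 1) W) : ctr e α ∈ ⋀[K]^k W := by
  let b := Module.finBasis K W
  have h : ∀ ξ, ∑ i, b.coord i ξ • b i = ξ := fun ξ => b.sum_repr ξ
  by_cases h0 : ctr e α = 0
  · rw [h0]; exact Submodule.zero_mem _
  have := numberOp_ctr h e α
  rw [numberOp_of_mem h hα, map_smul, Nat.cast_succ, add_smul, one_smul,
    add_sub_cancel_right] at this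
  obtain ⟨j, hj, hm⟩ := exists_mem_of_numberOp_eq h h0 this
  rwa [Nat.cast_inj.1 hj]

/-- Contractions have no component of top degree. -/
theorem apply_ctr_eq_zero [CharZero K] [FiniteDimensional K W] {f : ExteriorAlgebra K W →ₗ[K] K}
    (hf : ∀ k, k ≠ finrank K W → ∀ α ∈ ⋀[K]^k W, f α = 0) (e : Dual K W)
    (α : ExteriorAlgebra K W) : f (ctr e α) = 0 := by
  induction α using DirectSum.Decomposition.inductionOn (fun i : ℕ => ⋀[K]^i W) with
  | zero => simp
  | add x y hx hy => rw [map_add, map_add, hx, hy, add_zero]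
  | @homogeneous i m =>
    obtain ⟨m, hm⟩ := m
    rcases i with _ | i
    · obtain ⟨r, hr⟩ : m ∈ LinearMap.range (Algebra.linearMap K (ExteriorAlgebra K W)) := by
        rw [← Submodule.one_eq_range]
        simpa using hm
      change f (ctr e m) = 0
      rw [← hr, Algebra.linearMap_apply]
      change f (CliffordAlgebra.contractLeft (Q := (0 : QuadraticForm K W)) e _) = 0
      rw [CliffordAlgebra.contractLeft_algebraMap, map_zero]
    -- Only degree `finrank K W + 1` could contract into the top degree, and that exterior power is
    -- zero.
    · by_cases hi : i = finrank K W
      · have : m = 0 := eq_zero_of_mem_exteriorPower (by omega) hm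
        simp [this]
      · exact hf i hi _ (ctr_mem_exteriorPower e hm)

/-- This is the Leibniz rule: the involution absorbs its sign, and reversal on both sides of a left
contraction gives a right contraction. -/
theorem ctr_involute_mul (e : Dual K W) (x β : ExteriorAlgebra K W) :
    ctr e (CliffordAlgebra.involute x * β)
      = x * ctr e β - CliffordAlgebra.reverse (ctr e (CliffordAlgebra.reverse x)) * β := by
  induction x using CliffordAlgebra.right_induction generalizing β with
  | algebraMap r =>
    have h0 : ctr e (algebraMap K (ExteriorAlgebra K W) r) = 0 :=
      CliffordAlgebra.contractLeft_algebraMap (Q := (0 : QuadraticForm K W)) e r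
    have h1 : ctr e (algebraMap K (ExteriorAlgebra K W) r * β)
      = algebraMap K (ExteriorAlgebra K W) r * ctr e β :=
      CliffordAlgebra.contractLeft_algebraMap_mul (Q := (0 : QuadraticForm K W)) e r β
    rw [AlgHom.commutes, CliffordAlgebra.reverse.commutes, h0, h1, map_zero, zero_mul, sub_zero]
  | add x y hx hy => simp only [map_add, add_mul, hx, hy]; abel
  | mul_ι m x ih =>
    have h1 : CliffordAlgebra.involute (x * CliffordAlgebra.ι (0 : QuadraticForm K W) m) * β
        = -(CliffordAlgebra.involute x * wdg m β) := by
      rw [map_mul, CliffordAlgebra.involute_ι, mul_neg, neg_mul, mul_assoc]; rfl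
    have h2 : CliffordAlgebra.reverse (x * CliffordAlgebra.ι (0 : QuadraticForm K W) m)
        = wdg m (CliffordAlgebra.reverse x) := by
      rw [CliffordAlgebra.reverse.map_mul, CliffordAlgebra.reverse_ι]; rfl
    have h3 : ∀ y, CliffordAlgebra.reverse (wdg m y)
        = CliffordAlgebra.reverse y * ExteriorAlgebra.ι K m := fun y => by
      rw [LinearMap.mulLeft_apply]
      exact (CliffordAlgebra.reverse.map_mul _ _).trans
        (congrArg _ (CliffordAlgebra.reverse_ι (Q := (0 : QuadraticForm K W)) m))
    rw [h1, map_neg, ih, h2, ctr_wdg, ctr_wdg, map_sub, map_smul, h3,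
      CliffordAlgebra.reverse_reverse]
    change _ = x * ExteriorAlgebra.ι K m * _ - _
    simp only [LinearMap.mulLeft_apply, mul_sub, sub_mul, mul_assoc, mul_smul_comm,
      smul_mul_assoc]
    abel

/-- Integration by parts: `f` sees only the top degree, so it kills the contraction of a product,
and the Leibniz rule moves the contraction from one factor to the other. -/
theorem apply_reverse_ctr_mul [CharZero K] [FiniteDimensional K W]
    {f : ExteriorAlgebra K W →ₗ[K] K}
    (hf : ∀ k, k ≠ finrank K W → ∀ α ∈ ⋀[K]^k W, f α = 0) (e : Dual K W)
    (α β : ExteriorAlgebra K W) :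
    f (CliffordAlgebra.reverse (ctr e α) * β) = f (CliffordAlgebra.reverse α * ctr e β) := by
  have h := apply_ctr_eq_zero hf e
    (CliffordAlgebra.involute (CliffordAlgebra.reverse α) * β)
  rw [ctr_involute_mul, CliffordAlgebra.reverse_reverse, map_sub, sub_eq_zero] at h
  exact h.symm

end ExteriorNumberOperator

/-! ### Clifford multiplication by creation and annihilation operators on `⋀^• V^*_{0,1}`. -/

section SpinorModule

/-- For a unit vector `v`, `c` and `w` are contraction with `v` and exterior multiplication by
`g(v^{1,0})`, with anticommutator `1/2`, and `s = √2`. The bracket is that of the Clifford actions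
of `-J v` and `v`. -/
theorem lie_creation_annihilation {A : Type*} [Ring A] [Algebra ℂ A] {c w : A} {s : ℂ}
    (hs : s * s = 2) (hcc : c * c = 0) (hww : w * w = 0)
    (hcw : c * w = (1 / 2 : ℂ) • 1 - w * c) :
    ⁅-((s * Complex.I) • (w - c)), s • (c + w)⁆
      = (4 * Complex.I) • ((1 / 2 : ℂ) • 1 - (2 : ℂ) • (w * c)) := by
  rw [Ring.lie_def]
  simp only [neg_mul, mul_neg, smul_mul_assoc, mul_smul_comm, mul_add, add_mul, mul_sub,
    sub_mul, hww, hcc, hcw]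
  match_scalars
  · linear_combination (-4 * Complex.I) * hs
  · linear_combination Complex.I * hs

variable {V : Type*} [NormedAddCommGroup V] [InnerProductSpace ℝ V]

theorem evalAt_apply (v : V) (ξ : V →ₗ[ℝ] ℂ) : evalAt v ξ = ξ v := rfl

theorem cplx_flat_apply (v w : V) : cplx (flat v) w = (⟪v, w⟫ : ℂ) := rfl

namespace OrthComplexStructure

variable (𝒥 : OrthComplexStructure V)

/-- Evaluation of `(0,1)`-covectors at a real vector. -/
def ev01 : V →ₗ[ℝ] Dual ℂ 𝒥.forms01 where
  toFun v := (evalAt v).comp 𝒥.forms01.subtype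
  map_add' v w := by rw [map_add]; rfl
  map_smul' r v := by rw [map_smul]; rfl

theorem ev01_apply (v : V) (ξ : 𝒥.forms01) : 𝒥.ev01 v ξ = (ξ : V →ₗ[ℝ] ℂ) v := rfl

theorem ev01_J (v : V) : 𝒥.ev01 (𝒥.J v) = -Complex.I • 𝒥.ev01 v :=
  LinearMap.ext fun ξ => ξ.2 v

theorem flat01_apply (v w : V) : (𝒥.flat01 v : V →ₗ[ℝ] ℂ) w
    = (1 / 2 : ℂ) * ((⟪v, w⟫ : ℂ) - Complex.I * (⟪𝒥.J v, w⟫ : ℂ)) := rfl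

theorem flat01_J (v : V) : 𝒥.flat01 (𝒥.J v) = Complex.I • 𝒥.flat01 v := by
  apply Subtype.ext
  ext w
  rw [flat01_apply, Submodule.coe_smul, LinearMap.smul_apply, flat01_apply, 𝒥.sq, inner_neg_left,
    smul_eq_mul]
  push_cast
  linear_combination (1 / 2 : ℂ) * (⟪𝒥.J v, w⟫ : ℂ) * Complex.I_mul_I

theorem clif₀_eq (v : V) : 𝒥.clif₀ v =
    ((Real.sqrt 2 : ℝ) : ℂ) • (ctr (𝒥.ev01 v) + wdg (𝒥.flat01 v)) := rfl

theorem clif₀_J_eq (v : V) : 𝒥.clif₀ (𝒥.J v) =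
    (((Real.sqrt 2 : ℝ) : ℂ) * Complex.I) • (wdg (𝒥.flat01 v) - ctr (𝒥.ev01 v)) := by
  refine LinearMap.ext fun α => ?_
  rw [clif₀_eq, ev01_J, flat01_J]
  simp only [ctr, wdg, map_smul, LinearMap.smul_apply, LinearMap.add_apply, LinearMap.sub_apply,
    LinearMap.mulLeft_apply, smul_mul_assoc, neg_smul, map_neg, LinearMap.neg_apply, mul_smul,
    smul_sub, smul_add, smul_neg]
  abel

/-- This is the `(0,1)`-part of the expansion `ξ = ∑ ξ(eᵢ) g(eᵢ)`: the two terms of `flat01`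
contribute `ξ / 2` each, the second because `ξ ∘ J = -i ξ`. -/
theorem sum_ev01_smul_flat01 {I : Type*} [Fintype I] (e : OrthonormalBasis I ℝ V)
    (ξ : 𝒥.forms01) : ∑ i, 𝒥.ev01 (e i) ξ • 𝒥.flat01 (e i) = ξ := by
  have key : ∀ w, ∑ i, (ξ : V →ₗ[ℝ] ℂ) (e i) * (⟪e i, w⟫ : ℂ) = (ξ : V →ₗ[ℝ] ℂ) w := fun w => by
    conv_rhs => rw [← e.sum_repr' w, map_sum]
    refine Finset.sum_congr rfl fun i _ => ?_
    rw [map_smul, Complex.real_smul, mul_comm]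
  apply Subtype.ext
  ext w
  rw [Submodule.coe_sum, LinearMap.sum_apply]
  have h1 : ∀ i, (↑(𝒥.ev01 (e i) ξ • 𝒥.flat01 (e i)) : V →ₗ[ℝ] ℂ) w
      = (1 / 2 : ℂ) * ((ξ : V →ₗ[ℝ] ℂ) (e i) * (⟪e i, w⟫ : ℂ))
        + (1 / 2 : ℂ) * Complex.I * ((ξ : V →ₗ[ℝ] ℂ) (e i) * (⟪e i, 𝒥.J w⟫ : ℂ)) := fun i => by
    rw [Submodule.coe_smul, LinearMap.smul_apply, flat01_apply, 𝒥.inner_J_left, ev01_apply,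
      smul_eq_mul]
    push_cast
    ring
  simp only [h1, Finset.sum_add_distrib, ← Finset.mul_sum, key]
  rw [ξ.2 w]
  linear_combination (-(1 / 2 : ℂ) * (ξ : V →ₗ[ℝ] ℂ) w) * Complex.I_mul_I

theorem lie_clif₀_J (v : V) (hv : ‖v‖ = 1) : ⁅𝒥.clif₀ (-𝒥.J v), 𝒥.clif₀ v⁆
    = (4 * Complex.I) • ((1 / 2 : ℂ) • LinearMap.id
      - (2 : ℂ) • (wdg (𝒥.flat01 v) ∘ₗ ctr (𝒥.ev01 v))) := by
  have h2 : ((Real.sqrt 2 : ℝ) : ℂ) * ((Real.sqrt 2 : ℝ) : ℂ) = 2 := by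
    rw [← Complex.ofReal_mul, Real.mul_self_sqrt (by norm_num)]; simp
  have hcw : ctr (𝒥.ev01 v) * wdg (𝒥.flat01 v)
      = (1 / 2 : ℂ) • 1 - wdg (𝒥.flat01 v) * ctr (𝒥.ev01 v) := by
    refine LinearMap.ext fun α => ?_
    change ctr _ (wdg _ α) = _
    rw [ctr_wdg, ev01_apply, flat01_apply_self, real_inner_self_eq_norm_sq, hv]
    simp
  have hneg : 𝒥.clif₀ (-𝒥.J v) = -𝒥.clif₀ (𝒥.J v) := by
    rw [← neg_one_smul ℝ (𝒥.J v), clif₀_smul, Complex.ofReal_neg, Complex.ofReal_one]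
    exact neg_one_smul ℂ (𝒥.clif₀ (𝒥.J v))
  have hww : wdg (K := ℂ) (𝒥.flat01 v) * wdg (𝒥.flat01 v) = 0 := by
    refine LinearMap.ext fun α => ?_
    change ExteriorAlgebra.ι ℂ (𝒥.flat01 v) * (ExteriorAlgebra.ι ℂ (𝒥.flat01 v) * α) = 0
    rw [← mul_assoc, ExteriorAlgebra.ι_sq_zero, zero_mul]
  have hcc : ctr (𝒥.ev01 v) * ctr (𝒥.ev01 v) = 0 := by
    refine LinearMap.ext fun α => ?_
    exact CliffordAlgebra.contractLeft_contractLeft (Q := (0 : QuadraticForm ℂ 𝒥.forms01)) (𝒥.ev01 v) α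
  rw [hneg, clif₀_J_eq, clif₀_eq]
  exact lie_creation_annihilation h2 hcc hww hcw

variable [FiniteDimensional ℝ V]

theorem ev01_surjective : Function.Surjective 𝒥.ev01 := by
  intro d
  let e := stdOrthonormalBasis ℝ V
  -- Since `ev01 (J v) = -i ev01 v`, the real vector `a e - b J e` evaluates as `(a + i b) ev01 e`;
  -- here `a + i b = d (flat01 e)`.
  refine ⟨∑ i, ((d (𝒥.flat01 (e i))).re • e i - (d (𝒥.flat01 (e i))).im • 𝒥.J (e i)), ?_⟩
  ext ξ
  conv_rhs => rw [← 𝒥.sum_ev01_smul_flat01 e ξ, map_sum]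
  rw [map_sum, LinearMap.sum_apply]
  refine Finset.sum_congr rfl fun i _ => ?_
  rw [map_sub, map_smul, map_smul, ev01_J, map_smul]
  simp only [LinearMap.sub_apply, LinearMap.smul_apply, Complex.real_smul, smul_eq_mul]
  conv_rhs => rw [← Complex.re_add_im (d (𝒥.flat01 (e i)))]
  ring

/-- The dimension is the trace of the identity, resolved into `2n` rank-one operators of trace
`1/2`. -/
theorem finrank_forms01 {n : ℕ} (hV : finrank ℝ V = 2 * n) : finrank ℂ 𝒥.forms01 = n := by
  let e := stdOrthonormalBasis ℝ V
  have h : (LinearMap.id : 𝒥.forms01 →ₗ[ℂ] 𝒥.forms01)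
      = ∑ i, (𝒥.ev01 (e i)).smulRight (𝒥.flat01 (e i)) := by
    refine LinearMap.ext fun ξ => ?_
    simpa using (𝒥.sum_ev01_smul_flat01 e ξ).symm
  have h2 := congrArg (LinearMap.trace ℂ 𝒥.forms01) h
  rw [LinearMap.trace_id, map_sum] at h2
  have h3 : ∀ i, LinearMap.trace ℂ 𝒥.forms01 ((𝒥.ev01 (e i)).smulRight (𝒥.flat01 (e i)))
      = 1 / 2 := fun i => by
    rw [LinearMap.trace_smulRight, ev01_apply, flat01_apply_self, real_inner_self_eq_norm_sq,
      e.norm_eq_one]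
    norm_num
  simp only [h3, Finset.sum_const, Finset.card_univ, Fintype.card_fin, hV, nsmul_eq_mul] at h2
  push_cast at h2
  rw [show (2 * n : ℂ) * (1 / 2) = n by ring] at h2
  exact_mod_cast h2

/-- The degree operator on `⋀^• V^*_{0,1}`. -/
def degreeOp : Module.End ℂ (ExteriorAlgebra ℂ 𝒥.forms01) :=
  numberOp (fun i => 𝒥.flat01 (stdOrthonormalBasis ℝ V i))
    (fun i => 𝒥.ev01 (stdOrthonormalBasis ℝ V i))

theorem ker_degreeOp : LinearMap.ker 𝒥.degreeOp
    = LinearMap.range (Algebra.linearMap ℂ (ExteriorAlgebra ℂ 𝒥.forms01)) :=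
  ker_numberOp (𝒥.sum_ev01_smul_flat01 _)

/-- The spin lift of `-J` acts on `⋀^k V^*_{0,1}` as `i (n / 2 - k)`. -/
theorem sum_lie_clif₀_J {n : ℕ} (hV : finrank ℝ V = 2 * n) :
    (1 / 8 : ℂ) • ∑ i, ⁅𝒥.clif₀ (-𝒥.J (stdOrthonormalBasis ℝ V i)),
      𝒥.clif₀ (stdOrthonormalBasis ℝ V i)⁆
    = Complex.I • ((n / 2 : ℂ) • LinearMap.id - 𝒥.degreeOp) := by
  simp only [𝒥.lie_clif₀_J _ ((stdOrthonormalBasis ℝ V).norm_eq_one _), degreeOp, numberOp]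
  -- The scalar parts of the `2n` brackets add up to `4 n i`, and the factor `1/8` leaves `i n / 2`.
  have h : ((finrank ℝ V : ℕ) : ℂ) = 2 * n := by rw [hV]; push_cast; rfl
  rw [← Finset.smul_sum, Finset.sum_sub_distrib, Finset.sum_const, ← Finset.smul_sum,
    Finset.card_univ, Fintype.card_fin, ← Nat.cast_smul_eq_nsmul ℂ, h]
  module

/-- Spinors form an irreducible Clifford module. -/
theorem clif₀_irreducible {N : Submodule ℂ (ExteriorAlgebra ℂ 𝒥.forms01)}
    (hN : ∀ v, ∀ α ∈ N, 𝒥.clif₀ v α ∈ N) : N = ⊥ ∨ N = ⊤ := by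
  have hs : ((Real.sqrt 2 : ℝ) : ℂ) ≠ 0 := by
    rw [Ne, Complex.ofReal_eq_zero]
    positivity
  -- Up to nonzero scalars, `v` and `J v` act as the sum and the difference of a wedge and a
  -- contraction, so `N` is stable under each of these separately.
  have hcw : ∀ v, ∀ α ∈ N, ctr (𝒥.ev01 v) α + wdg (𝒥.flat01 v) α ∈ N := fun v α hα => by
    have := N.smul_mem ((Real.sqrt 2 : ℝ) : ℂ)⁻¹ (hN v α hα)
    rwa [clif₀_eq, LinearMap.smul_apply, smul_smul, inv_mul_cancel₀ hs, one_smul] at this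
  have hcw' : ∀ v, ∀ α ∈ N, wdg (𝒥.flat01 v) α - ctr (𝒥.ev01 v) α ∈ N := fun v α hα => by
    have := N.smul_mem (((Real.sqrt 2 : ℝ) : ℂ) * Complex.I)⁻¹ (hN (𝒥.J v) α hα)
    rwa [clif₀_J_eq, LinearMap.smul_apply, smul_smul,
      inv_mul_cancel₀ (mul_ne_zero hs Complex.I_ne_zero), one_smul] at this
  have hw : ∀ v, ∀ α ∈ N, wdg (𝒥.flat01 v) α ∈ N := fun v α hα => by
    have := N.smul_mem (1 / 2 : ℂ) (N.add_mem (hcw v α hα) (hcw' v α hα))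
    convert this using 1
    module
  have hc : ∀ v, ∀ α ∈ N, ctr (𝒥.ev01 v) α ∈ N := fun v α hα => by
    have := N.sub_mem (hcw v α hα) (hw v α hα)
    rwa [add_sub_cancel_right] at this
  refine eq_bot_or_eq_top (fun d α hα => ?_) fun w α hα => ?_
  · obtain ⟨v, rfl⟩ := 𝒥.ev01_surjective d
    exact hc v α hα
  · rw [← 𝒥.sum_ev01_smul_flat01 (stdOrthonormalBasis ℝ V) w]
    simp only [LinearMap.mulLeft_apply, map_sum, map_smul, Finset.sum_mul, smul_mul_assoc]
    exact N.sum_mem fun i _ => N.smul_mem _ (hw _ α hα)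

end OrthComplexStructure
end SpinorModule

/-! ### Burnside's theorem. -/

section Density

variable {S : Type*} [AddCommGroup S] [Module ℂ S] [FiniteDimensional ℂ S] [Nontrivial S]

/-- Burnside's theorem: an irreducible algebra of operators on a finite-dimensional complex vector
space consists of all operators. -/
theorem mem_of_irreducible (A : Subalgebra ℂ (Module.End ℂ S))
    (h : ∀ N : Submodule ℂ S, (∀ a ∈ A, ∀ x ∈ N, a x ∈ N) → N = ⊥ ∨ N = ⊤)
    (f : Module.End ℂ S) : f ∈ A := by
  have hsimple : IsSimpleModule A S := by
    refine (isSimpleModule_iff _ _).2 { eq_bot_or_eq_top := fun N => ?_ }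
    rcases h (N.restrictScalars ℂ) (fun a ha x hx => N.smul_mem ⟨a, ha⟩ hx) with h0 | h0
    · left
      exact (Submodule.restrictScalars_eq_bot_iff _ _ _).1 h0
    · right
      exact (Submodule.restrictScalars_eq_top_iff _ _ _).1 h0
  -- By Schur's lemma the commutant of `A` is `ℂ`, so `f` commutes with it; the density theorem then
  -- yields an element of `A` equal to `f` on a finite spanning set.
  have hend := (IsSimpleModule.algebraMap_end_bijective_of_isAlgClosed (A := A) (V := S) ℂ).2
  let F : Module.End (Module.End A S) S :=
    { toFun := f
      map_add' := f.map_add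
      map_smul' := fun g x => by
        obtain ⟨c, rfl⟩ := hend g
        exact f.map_smul c x }
  obtain ⟨s, hs⟩ := Module.Finite.fg_top (R := ℂ) (M := S)
  obtain ⟨r, hr⟩ := jacobson_density F s
  have : f = (r : Module.End ℂ S) :=
    LinearMap.ext_on hs fun m hm => hr m hm
  rw [this]
  exact r.2

end Density

/-! ### Complexified Clifford algebras: universal property and dimension. -/

section ComplexLift

variable {V : Type*} [NormedAddCommGroup V] [InnerProductSpace ℝ V]
variable {Q : QuadraticForm ℝ V} {A : Type*} [Ring A] [Algebra ℂ A] {f : V → A}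
    (hadd : ∀ v w, f (v + w) = f v + f w) (hsmul : ∀ (r : ℝ) v, f (r • v) = (r : ℂ) • f v)
    (hsq : ∀ v, f v * f v = algebraMap ℂ A (Q v : ℝ))

theorem complexLift_tmul_one (z : ℂ) :
    complexLift Q f hadd hsmul hsq (z ⊗ₜ 1) = algebraMap ℂ A z := by
  simp [complexLift, Algebra.algebraMap_eq_smul_one]

theorem complexLift_ι (v : V) :
    complexLift Q f hadd hsmul hsq (1 ⊗ₜ CliffordAlgebra.ι Q v) = f v := by
  let _ : Algebra ℝ A := Algebra.complexToReal
  have : CliffordAlgebra.lift Q ⟨({ toFun := f, map_add' := hadd, map_smul' := hsmul } : V →ₗ[ℝ] A),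
    hsq⟩ (CliffordAlgebra.ι Q v) = f v := CliffordAlgebra.lift_ι_apply _ _ v
  simp [complexLift, this]

theorem complexLift_mul (x y : ℂ ⊗[ℝ] CliffordAlgebra Q) :
    complexLift Q f hadd hsmul hsq (x * y)
      = complexLift Q f hadd hsmul hsq x * complexLift Q f hadd hsmul hsq y := by
  induction x using TensorProduct.induction_on with
  | zero => simp
  | add a b ha hb => rw [add_mul, map_add, ha, hb, map_add, add_mul]
  | tmul z a =>
    induction y using TensorProduct.induction_on with
    | zero => simp
    | add c d hc hd => rw [mul_add, map_add, hc, hd, map_add, mul_add]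
    | tmul w b =>
      simp [complexLift, Algebra.TensorProduct.tmul_mul_tmul, mul_smul]
      rw [smul_comm]

/-- `complexLift` as a homomorphism of complex algebras. -/
def complexLiftHom : ℂ ⊗[ℝ] CliffordAlgebra Q →ₐ[ℂ] A :=
  AlgHom.ofLinearMap (complexLift Q f hadd hsmul hsq)
    (by rw [Algebra.TensorProduct.one_def, complexLift_tmul_one, map_one])
    (complexLift_mul hadd hsmul hsq)

theorem complexLift_surjective_of_adjoin (h : Algebra.adjoin ℂ (Set.range f) = ⊤) :
    Function.Surjective (complexLift Q f hadd hsmul hsq) := by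
  change Function.Surjective (complexLiftHom hadd hsmul hsq)
  rw [← AlgHom.range_eq_top, eq_top_iff, ← h]
  refine Algebra.adjoin_le ?_
  rintro _ ⟨v, rfl⟩
  exact ⟨1 ⊗ₜ CliffordAlgebra.ι Q v, complexLift_ι hadd hsmul hsq v⟩

variable [FiniteDimensional ℝ V]

instance : FiniteDimensional ℝ (CliffordAlgebra Q) :=
  let _ : Invertible (2 : ℝ) := invertibleOfNonzero two_ne_zero
  (CliffordAlgebra.equivExterior Q).symm.finiteDimensional

theorem finrank_complex_clifford (Q : QuadraticForm ℝ V) :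
    finrank ℂ (ℂ ⊗[ℝ] CliffordAlgebra Q) = 2 ^ finrank ℝ V := by
  let _ : Invertible (2 : ℝ) := invertibleOfNonzero two_ne_zero
  rw [finrank_baseChange, (CliffordAlgebra.equivExterior Q).finrank_eq, finrank_exteriorAlgebra]

end ComplexLift

/-! ### The twisted spinors and bijectivity of `ρ`. -/

namespace OrthComplexStructure

variable {V : Type*} [NormedAddCommGroup V] [InnerProductSpace ℝ V] (𝒥 : OrthComplexStructure V)

/-- The conjugate complex structure `-J`. -/
def conj : OrthComplexStructure V where
  J := -𝒥.J
  sq v := by simp [𝒥.sq]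
  orth v w := by simp [𝒥.orth]

/-- This makes the dimension count for `(0,1)`-covectors available for `(1,0)`-covectors. -/
theorem forms01_conj : 𝒥.conj.forms01 = 𝒥.forms10 := by
  ext ξ
  change (∀ v, ξ (-𝒥.J v) = -Complex.I * ξ v) ↔ ∀ v, ξ (𝒥.J v) = Complex.I * ξ v
  simp only [map_neg, neg_mul, neg_inj]

variable (L : Type*) [AddCommGroup L] [Module ℂ L]

theorem clif_tmul (v : V) (α : ExteriorAlgebra ℂ 𝒥.forms01) (s : L) :
    𝒥.clif L v (α ⊗ₜ s) = 𝒥.clif₀ v α ⊗ₜ s := rfl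

theorem spinRep_ι (v : V) :
    𝒥.spinRep L (1 ⊗ₜ CliffordAlgebra.ι (metricForm V) v) = 𝒥.clif L v :=
  complexLift_ι _ _ _ v

theorem spinRep_mul (x y : ℂ ⊗[ℝ] CliffordAlgebra (metricForm V)) :
    𝒥.spinRep L (x * y) = 𝒥.spinRep L x * 𝒥.spinRep L y :=
  complexLift_mul _ _ _ x y

variable [FiniteDimensional ℝ V] {n : ℕ}

theorem finrank_canonicalLine (hV : finrank ℝ V = 2 * n) : finrank ℂ (𝒥.canonicalLine n) = 1 := by
  rw [exteriorPower.finrank_eq, ← forms01_conj, 𝒥.conj.finrank_forms01 hV, Nat.choose_self]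

variable {L}

theorem finrank_sqrt (hV : finrank ℝ V = 2 * n) (sq : L ⊗[ℂ] L ≃ₗ[ℂ] 𝒥.canonicalLine n) :
    finrank ℂ L = 1 := by
  have h := sq.finrank_eq
  rw [finrank_canonicalLine 𝒥 hV, finrank_tensorProduct] at h
  exact Nat.eq_one_of_mul_eq_one_right h

theorem tmul_bijective (hL : finrank ℂ L = 1) {s : L} (hs : s ≠ 0) :
    Function.Bijective ((TensorProduct.mk ℂ (ExteriorAlgebra ℂ 𝒥.forms01) L).flip s) := by
  have : FiniteDimensional ℂ L := Module.finite_of_finrank_eq_succ hL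
  have hsurj : Function.Surjective
      ((TensorProduct.mk ℂ (ExteriorAlgebra ℂ 𝒥.forms01) L).flip s) := by
    intro x
    induction x using TensorProduct.induction_on with
    | zero => exact ⟨0, map_zero _⟩
    | add a b ha hb =>
      obtain ⟨a, rfl⟩ := ha
      obtain ⟨b, rfl⟩ := hb
      exact ⟨a + b, map_add _ a b⟩
    | tmul α t =>
      obtain ⟨c, rfl⟩ := exists_smul_eq_of_finrank_eq_one hL hs t
      exact ⟨c • α, by simp⟩
  refine ⟨(LinearMap.injective_iff_surjective_of_finrank_eq_finrank ?_).2 hsurj, hsurj⟩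
  rw [finrank_tensorProduct, hL, mul_one]

theorem spinor_irreducible (hL : finrank ℂ L = 1) {N : Submodule ℂ (𝒥.Spinor L)}
    (hN : ∀ v, ∀ φ ∈ N, 𝒥.clif L v φ ∈ N) : N = ⊥ ∨ N = ⊤ := by
  have : FiniteDimensional ℂ L := Module.finite_of_finrank_eq_succ hL
  obtain ⟨s, hs⟩ := finrank_pos_iff_exists_ne_zero.1 (hL ▸ Nat.one_pos : 0 < finrank ℂ L)
  let e := LinearEquiv.ofBijective _ (𝒥.tmul_bijective hL hs)
  rcases 𝒥.clif₀_irreducible (N := N.comap e.toLinearMap) (fun v α hα => hN v _ hα) with h | h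
  · left
    rw [eq_bot_iff]
    intro φ hφ
    have : e.symm φ ∈ N.comap e.toLinearMap := by
      rw [Submodule.mem_comap]
      exact (e.apply_symm_apply φ).symm ▸ hφ
    rw [h, Submodule.mem_bot, LinearEquiv.map_eq_zero_iff] at this
    exact this
  · right
    rw [eq_top_iff]
    intro φ _
    have : e.symm φ ∈ N.comap e.toLinearMap := h ▸ Submodule.mem_top
    rw [Submodule.mem_comap] at this
    exact (e.apply_symm_apply φ) ▸ this

theorem finrank_spinor (hV : finrank ℝ V = 2 * n) (hL : finrank ℂ L = 1) :
    finrank ℂ (𝒥.Spinor L) = 2 ^ n := by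
  rw [finrank_tensorProduct, hL, mul_one, finrank_exteriorAlgebra, 𝒥.finrank_forms01 hV]

/-- Irreducibility and Burnside's theorem give surjectivity; both sides have dimension `4^n`. -/
theorem spinRep_bijective (hV : finrank ℝ V = 2 * n) (hL : finrank ℂ L = 1) :
    Function.Bijective (𝒥.spinRep L) := by
  have : FiniteDimensional ℂ L := Module.finite_of_finrank_eq_succ hL
  have hnt : Nontrivial (𝒥.Spinor L) :=
    nontrivial_of_finrank_pos (R := ℂ) (by rw [𝒥.finrank_spinor hV hL]; positivity)
  have hadj : Algebra.adjoin ℂ (Set.range (𝒥.clif L)) = ⊤ := eq_top_iff.2 fun f _ =>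
    mem_of_irreducible _ (fun N hN => 𝒥.spinor_irreducible hL
      fun v φ hφ => hN _ (Algebra.subset_adjoin (Set.mem_range_self v)) φ hφ) f
  have hsurj : Function.Surjective (𝒥.spinRep L) :=
    complexLift_surjective_of_adjoin _ _ _ hadj
  have hf : finrank ℂ (ℂ ⊗[ℝ] CliffordAlgebra (metricForm V))
      = finrank ℂ (Module.End ℂ (𝒥.Spinor L)) := by
    rw [finrank_complex_clifford, finrank_linearMap, 𝒥.finrank_spinor hV hL, hV, two_mul, pow_add]
  have h := LinearMap.injective_iff_surjective_of_finrank_eq_finrank (K := ℂ)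
    (V := ℂ ⊗[ℝ] CliffordAlgebra (metricForm V)) (V₂ := Module.End ℂ (𝒥.Spinor L)) hf
    (f := 𝒥.spinRep L)
  exact ⟨h.2 hsurj, hsurj⟩

end OrthComplexStructure

/-! ### The symbol map and one-sided Clifford multiplication. -/

section Symbol

variable {V : Type*} [NormedAddCommGroup V] [InnerProductSpace ℝ V]

theorem gact_eq (A : GTan V) : gact A = ctr (evalAt A.1) + wdg (cplx A.2) := rfl

theorem gact_gact (A B : GTan V) (Φ : Forms V) :
    gact A (gact B Φ) = (pairing A B : ℂ) • Φ - gact B (gact A Φ) := by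
  have h1 : ∀ (X : V) (ξ : Dual ℝ V), evalAt X (cplx ξ) = (ξ X : ℂ) := fun _ _ => rfl
  simp only [gact_eq, LinearMap.add_apply, map_add, ctr_wdg, h1, pairing, Complex.ofReal_add,
    add_smul]
  rw [ctr_ctr (evalAt A.1) (evalAt B.1), wdg_wdg (cplx A.2) (cplx B.2)]
  abel

theorem gact_add (A B : GTan V) : gact (A + B) = gact A + gact B := by
  refine LinearMap.ext fun Φ => ?_
  simp only [gact_eq, Prod.fst_add, Prod.snd_add, map_add, LinearMap.add_apply,
    LinearMap.mulLeft_apply, add_mul]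
  abel

theorem gact_smul (r : ℝ) (A : GTan V) : gact (r • A) = (r : ℂ) • gact A := by
  have h1 : evalAt (r • A.1) = (r : ℂ) • evalAt A.1 := by
    ext ξ; simp [evalAt]
  have h2 : cplx (r • A.2) = (r : ℂ) • cplx A.2 := by ext w; simp [cplx]
  refine LinearMap.ext fun Φ => ?_
  simp only [gact_eq, Prod.smul_fst, Prod.smul_snd, h1, h2, map_smul, LinearMap.add_apply,
    LinearMap.smul_apply, LinearMap.mulLeft_apply, smul_mul_assoc, smul_add]

theorem cplx_flat_smul (r : ℝ) (v : V) :
    ExteriorAlgebra.ι ℂ (cplx (flat (r • v))) = (r : ℂ) • ExteriorAlgebra.ι ℂ (cplx (flat v)) := by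
  have h : cplx (flat (r • v)) = (r : ℂ) • cplx (flat v) := by ext w; simp [cplx]
  rw [h, map_smul]

variable (V) in
/-- The isomorphism `⋀^• V ⊗ ℂ → ⋀^•(V^* ⊗ ℂ)` that lowers indices. -/
def lowerMap : ℂ ⊗[ℝ] CliffordAlgebra (0 : QuadraticForm ℝ V) →ₗ[ℂ] Forms V :=
  complexLift (0 : QuadraticForm ℝ V) (fun v => ExteriorAlgebra.ι ℂ (cplx (flat v)))
    (fun v w => by simp only [map_add]) cplx_flat_smul (fun v => by simp)

theorem lowerMap_ι_mul (z : ℂ) (v : V) (x : ExteriorAlgebra ℝ V) :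
    lowerMap V (z ⊗ₜ wdg v x) = wdg (cplx (flat v)) (lowerMap V (z ⊗ₜ x)) := by
  have h : (z ⊗ₜ wdg v x : ℂ ⊗[ℝ] CliffordAlgebra (0 : QuadraticForm ℝ V))
      = (1 ⊗ₜ CliffordAlgebra.ι (0 : QuadraticForm ℝ V) v) * (z ⊗ₜ x) := by
    rw [Algebra.TensorProduct.tmul_mul_tmul, one_mul]
    rfl
  rw [h, lowerMap, complexLift_mul, complexLift_ι]
  rfl

theorem lowerMap_ctr (z : ℂ) (v : V) (x : ExteriorAlgebra ℝ V) :
    lowerMap V (z ⊗ₜ ctr (innerₗ V v) x) = ctr (evalAt v) (lowerMap V (z ⊗ₜ x)) := by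
  induction x using CliffordAlgebra.left_induction with
  | algebraMap r =>
    have h : lowerMap V (z ⊗ₜ algebraMap ℝ (CliffordAlgebra (0 : QuadraticForm ℝ V)) r)
        = algebraMap ℂ (Forms V) (r • z) := by
      rw [Algebra.algebraMap_eq_smul_one, ← TensorProduct.smul_tmul]
      exact complexLift_tmul_one _ _ _ _
    have h1 : ctr (innerₗ V v) (algebraMap ℝ (CliffordAlgebra (0 : QuadraticForm ℝ V)) r) = 0 :=
      CliffordAlgebra.contractLeft_algebraMap (Q := (0 : QuadraticForm ℝ V)) _ r
    have h2 : ctr (evalAt v) (algebraMap ℂ (Forms V) (r • z)) = 0 :=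
      CliffordAlgebra.contractLeft_algebraMap (Q := (0 : QuadraticForm ℂ (V →ₗ[ℝ] ℂ))) _ _
    rw [h, h1, h2, TensorProduct.tmul_zero, map_zero]
  | add x y hx hy => simp only [map_add, TensorProduct.tmul_add, hx, hy]
  | ι_mul x w ih =>
    change lowerMap V (z ⊗ₜ ctr (innerₗ V v) (wdg w x)) = ctr (evalAt v) (lowerMap V (z ⊗ₜ wdg w x))
    rw [ctr_wdg, lowerMap_ι_mul, ctr_wdg, ← ih, TensorProduct.tmul_sub, map_sub, lowerMap_ι_mul]
    congr 1
    rw [TensorProduct.tmul_smul, TensorProduct.smul_tmul', ← Complex.coe_smul,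
      ← TensorProduct.smul_tmul', map_smul, evalAt_apply, cplx_flat_apply, innerₗ_apply_apply,
      real_inner_comm]

/-- `equivExterior` changes the form by the bilinear form of `-metricForm V`; its sign cancels the
one in `changeForm_ι_mul`, so the contraction enters with a plus. -/
theorem equivExterior_ι_mul [Invertible (2 : ℝ)] (v : V) (a : CliffordAlgebra (metricForm V)) :
    CliffordAlgebra.equivExterior (metricForm V) (CliffordAlgebra.ι (metricForm V) v * a)
      = wdg v (CliffordAlgebra.equivExterior (metricForm V) a)
        + ctr (innerₗ V v) (CliffordAlgebra.equivExterior (metricForm V) a) := by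
  refine (CliffordAlgebra.changeForm_ι_mul
    CliffordAlgebra.changeForm.associated_neg_proof v a).trans ?_
  have h : (QuadraticMap.associated (R := ℝ) (-metricForm V)) v = -innerₗ V v := by
    ext w
    rw [map_neg, LinearMap.neg_apply, metricForm, QuadraticMap.associated_left_inverse']
    ext x y
    exact real_inner_comm _ _
  have h2 : ∀ y : ExteriorAlgebra ℝ V,
      ctr ((QuadraticMap.associated (R := ℝ) (-metricForm V)) v) y = -ctr (innerₗ V v) y := fun y => by
    rw [h, ctr, map_neg, LinearMap.neg_apply]
  refine (sub_eq_add_neg _ _).trans (congrArg _ ?_)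
  exact neg_eq_iff_eq_neg.2 (h2 _)

theorem symbolMap_one_tmul_one : symbolMap (1 ⊗ₜ 1 : ℂ ⊗[ℝ] CliffordAlgebra (metricForm V)) = 1 := by
  let _ : Invertible (2 : ℝ) := invertibleOfNonzero two_ne_zero
  have h : CliffordAlgebra.equivExterior (metricForm V) 1 = 1 :=
    CliffordAlgebra.changeForm_one CliffordAlgebra.changeForm.associated_neg_proof
  change lowerMap V (1 ⊗ₜ CliffordAlgebra.equivExterior (metricForm V) 1) = 1
  rw [h]
  exact (complexLift_tmul_one _ _ _ _).trans (map_one _)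

theorem symbolMap_ι_mul (v : V) (x : ℂ ⊗[ℝ] CliffordAlgebra (metricForm V)) :
    symbolMap ((1 ⊗ₜ CliffordAlgebra.ι (metricForm V) v) * x)
      = gact ((v, flat v) : GTan V) (symbolMap x) := by
  let _ : Invertible (2 : ℝ) := invertibleOfNonzero two_ne_zero
  induction x using TensorProduct.induction_on with
  | zero => simp
  | add x y hx hy => rw [mul_add, map_add, map_add, map_add, hx, hy]
  | tmul z a =>
    rw [Algebra.TensorProduct.tmul_mul_tmul, one_mul]
    change lowerMap V (z ⊗ₜ CliffordAlgebra.equivExterior (metricForm V) _)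
      = gact ((v, flat v) : GTan V) (lowerMap V (z ⊗ₜ CliffordAlgebra.equivExterior (metricForm V) a))
    rw [equivExterior_ι_mul, TensorProduct.tmul_add, map_add, lowerMap_ι_mul, lowerMap_ctr,
      gact_eq, LinearMap.add_apply, add_comm]

theorem symbolMap_tmul (z : ℂ) (a : CliffordAlgebra (metricForm V)) :
    symbolMap (z ⊗ₜ a) = z • symbolMap (1 ⊗ₜ a) := by
  rw [← map_smul, TensorProduct.smul_tmul', smul_eq_mul, mul_one]

/-- The graphs of `g` and `-g` are orthogonal for the pairing, so their actions anticommute.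
Induction on left factors therefore reduces the claim to scalars, the involution absorbing the
signs. -/
theorem symbolMap_involute_mul_ι (v : V) (a : CliffordAlgebra (metricForm V)) :
    symbolMap (1 ⊗ₜ (CliffordAlgebra.involute a * CliffordAlgebra.ι (metricForm V) v))
      = -gact ((v, -flat v) : GTan V) (symbolMap (1 ⊗ₜ a)) := by
  have hmul : ∀ (w : V) (b : CliffordAlgebra (metricForm V)),
      symbolMap (1 ⊗ₜ (CliffordAlgebra.ι (metricForm V) w * b))
        = gact ((w, flat w) : GTan V) (symbolMap (1 ⊗ₜ b)) := fun w b => by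
    rw [← symbolMap_ι_mul, Algebra.TensorProduct.tmul_mul_tmul, one_mul]
  induction a using CliffordAlgebra.left_induction with
  | algebraMap r =>
    rw [AlgHom.commutes, Algebra.algebraMap_eq_smul_one, smul_mul_assoc, one_mul,
      TensorProduct.tmul_smul, TensorProduct.tmul_smul, ← mul_one (CliffordAlgebra.ι _ v),
      TensorProduct.smul_tmul', TensorProduct.smul_tmul', symbolMap_tmul, symbolMap_tmul (r • 1),
      hmul, symbolMap_one_tmul_one, map_smul, ← smul_neg]
    congr 1
    have h1 : ∀ d : Dual ℂ (V →ₗ[ℝ] ℂ), ctr d 1 = 0 := fun d =>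
      CliffordAlgebra.contractLeft_one (Q := (0 : QuadraticForm ℂ (V →ₗ[ℝ] ℂ))) d
    simp [gact_eq, h1]
  | add x y hx hy => simp only [map_add, add_mul, TensorProduct.tmul_add, hx, hy]; abel
  | ι_mul x w ih =>
    have hp : pairing ((w, flat w) : GTan V) ((v, -flat v) : GTan V) = 0 := by
      simp [pairing, flat, real_inner_comm]
    rw [map_mul, CliffordAlgebra.involute_ι, neg_mul, neg_mul, TensorProduct.tmul_neg, map_neg,
      mul_assoc, hmul, ih, hmul, map_neg, neg_neg, gact_gact, hp, Complex.ofReal_zero, zero_smul,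
      zero_sub]

/-- Right multiplication by `v w` corresponds to the action of the negative graph of `g`. -/
theorem symbolMap_mul_ι_mul_ι (v w : V) (x : ℂ ⊗[ℝ] CliffordAlgebra (metricForm V)) :
    symbolMap (x * (1 ⊗ₜ CliffordAlgebra.ι (metricForm V) v)
        * (1 ⊗ₜ CliffordAlgebra.ι (metricForm V) w))
      = -gact ((w, -flat w) : GTan V) (gact ((v, -flat v) : GTan V) (symbolMap x)) := by
  induction x using TensorProduct.induction_on with
  | zero => simp
  | add x y hx hy => rw [add_mul, add_mul, map_add, hx, hy, map_add, map_add, map_add, neg_add]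
  | tmul z a =>
    have h1 := symbolMap_involute_mul_ι v a
    have h2 := symbolMap_involute_mul_ι w
      (CliffordAlgebra.involute a * CliffordAlgebra.ι (metricForm V) v)
    rw [map_mul, CliffordAlgebra.involute_involute, CliffordAlgebra.involute_ι, h1, mul_neg,
      neg_mul, TensorProduct.tmul_neg, map_neg, map_neg, neg_neg] at h2
    rw [Algebra.TensorProduct.tmul_mul_tmul, Algebra.TensorProduct.tmul_mul_tmul, mul_one, mul_one,
      symbolMap_tmul, symbolMap_tmul z a, map_smul, map_smul, ← smul_neg, ← h2, neg_neg]

variable [FiniteDimensional ℝ V]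

theorem adjoin_cplx_flat :
    Algebra.adjoin ℂ (Set.range fun v : V => ExteriorAlgebra.ι ℂ (cplx (flat v))) = ⊤ := by
  rw [eq_top_iff, ← CliffordAlgebra.adjoin_range_ι]
  refine Algebra.adjoin_le ?_
  rintro _ ⟨ξ, rfl⟩
  let e := stdOrthonormalBasis ℝ V
  have hξ : ξ = ∑ i, ξ (e i) • cplx (flat (e i)) := by
    ext w
    conv_lhs => rw [← e.sum_repr' w, map_sum]
    rw [LinearMap.sum_apply]
    refine Finset.sum_congr rfl fun i _ => ?_
    rw [map_smul, LinearMap.smul_apply, cplx_flat_apply, Complex.real_smul, smul_eq_mul, mul_comm]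
  rw [hξ, map_sum]
  refine Subalgebra.sum_mem _ fun i _ => ?_
  rw [map_smul]
  exact Subalgebra.smul_mem _ (Algebra.subset_adjoin (Set.mem_range_self (e i))) _

theorem symbolMap_bijective : Function.Bijective (symbolMap (V := V)) := by
  let _ : Invertible (2 : ℝ) := invertibleOfNonzero two_ne_zero
  have hsurj : Function.Surjective (symbolMap (V := V)) := by
    have h1 : Function.Surjective (lowerMap V) :=
      complexLift_surjective_of_adjoin _ _ _ adjoin_cplx_flat
    have h2 := LinearMap.lTensor_surjective ℂ
      (CliffordAlgebra.equivExterior (metricForm V)).surjective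
    exact h1.comp h2
  have hf : finrank ℂ (ℂ ⊗[ℝ] CliffordAlgebra (metricForm V)) = finrank ℂ (Forms V) := by
    rw [finrank_complex_clifford, finrank_exteriorAlgebra, finrank_linearMap, finrank_self, mul_one]
  have h := LinearMap.injective_iff_surjective_of_finrank_eq_finrank (K := ℂ)
    (V := ℂ ⊗[ℝ] CliffordAlgebra (metricForm V)) (V₂ := Forms V) hf (f := symbolMap)
  exact ⟨h.2 hsurj, hsurj⟩

end Symbol

/-! ### The spinor pairing `q`: symmetry, nondegeneracy, and `q^♯`. -/

section Pairing

variable {V : Type*} [NormedAddCommGroup V] [InnerProductSpace ℝ V]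

theorem evalForm_ιMulti (W : Submodule ℂ (V →ₗ[ℝ] ℂ)) {m : ℕ} (v : Fin m → V) (ξ : Fin m → W) :
    evalForm W v (ExteriorAlgebra.ιMulti ℂ m ξ)
      = (Matrix.of fun i j => (ξ i : V →ₗ[ℝ] ℂ) (v j)).det := by
  rw [evalForm, ExteriorAlgebra.liftAlternating_apply_ιMulti, Pi.single_eq_same]
  rfl

theorem evalForm_eq_zero (W : Submodule ℂ (V →ₗ[ℝ] ℂ)) {m k : ℕ} (hk : k ≠ m) (v : Fin m → V)
    {α : ExteriorAlgebra ℂ W} (hα : α ∈ ⋀[ℂ]^k W) : evalForm W v α = 0 := by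
  rw [← ExteriorAlgebra.ιMulti_span_fixedDegree] at hα
  induction hα using Submodule.span_induction with
  | mem x hx =>
    obtain ⟨ξ, rfl⟩ := hx
    rw [evalForm, ExteriorAlgebra.liftAlternating_apply_ιMulti, Pi.single_eq_of_ne hk]
    rfl
  | zero => simp
  | add x y _ _ hx hy => rw [map_add, hx, hy, add_zero]
  | smul c x _ hx => rw [map_smul, hx, smul_zero]

namespace OrthComplexStructure

variable (𝒥 : OrthComplexStructure V)

/-- Complex conjugation of `(0,1)`-covectors. -/
def conj01 (ξ : 𝒥.forms01) : 𝒥.forms10 :=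
  ⟨Complex.conjAe.toLinearMap ∘ₗ (ξ : V →ₗ[ℝ] ℂ), fun v => by
    rw [LinearMap.comp_apply, ξ.2 v]
    simp⟩

theorem evalForm_conj01 {m : ℕ} (v : Fin m → V) (ξ : Fin m → 𝒥.forms01) :
    evalForm 𝒥.forms10 v (ExteriorAlgebra.ιMulti ℂ m fun i => 𝒥.conj01 (ξ i))
      = starRingEnd ℂ (evalForm 𝒥.forms01 v (ExteriorAlgebra.ιMulti ℂ m ξ)) := by
  rw [evalForm_ιMulti, evalForm_ιMulti, RingHom.map_det]
  rfl

variable [FiniteDimensional ℝ V] {n : ℕ}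

/-- The complex-bilinear metric pairing of forms of degree `n`. -/
def metricPairing (n : ℕ) (κ : ExteriorAlgebra ℂ 𝒥.forms10) : ExteriorAlgebra ℂ 𝒥.forms01 →ₗ[ℂ] ℂ :=
  (1 / (n.factorial : ℂ)) • ∑ I : Fin n → Fin (finrank ℝ V),
    evalForm 𝒥.forms10 (fun j => stdOrthonormalBasis ℝ V (I j)) κ •
      evalForm 𝒥.forms01 (fun j => stdOrthonormalBasis ℝ V (I j))

theorem metricPairing_eq_zero {k : ℕ} (hk : k ≠ n) (κ : ExteriorAlgebra ℂ 𝒥.forms10)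
    {α : ExteriorAlgebra ℂ 𝒥.forms01} (hα : α ∈ ⋀[ℂ]^k 𝒥.forms01) :
    𝒥.metricPairing n κ α = 0 := by
  simp [metricPairing, evalForm_eq_zero _ hk _ hα]

/-- For a top form `α` and `κ` its conjugate, the pairing is a positive multiple of `∑ |α(e_I)|²`.
-/
theorem exists_metricPairing_ne_zero (hV : finrank ℝ V = 2 * n) :
    ∃ (κ : 𝒥.canonicalLine n) (α : ExteriorAlgebra ℂ 𝒥.forms01), 𝒥.metricPairing n κ α ≠ 0 := by
  let b : Basis (Fin n) ℂ 𝒥.forms01 := Module.finBasisOfFinrankEq ℂ _ (𝒥.finrank_forms01 hV)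
  -- Real vectors whose evaluations form the dual basis, so that the top form takes the value `1` on
  -- them.
  choose v hv using fun j => 𝒥.ev01_surjective (b.coord j)
  refine ⟨⟨ExteriorAlgebra.ιMulti ℂ n fun i => 𝒥.conj01 (b i), ?_⟩,
    ExteriorAlgebra.ιMulti ℂ n b, fun h0 => ?_⟩
  · rw [canonicalLine, ← ExteriorAlgebra.ιMulti_span_fixedDegree]
    exact Submodule.subset_span (Set.mem_range_self _)
  have hfac : (1 / (n.factorial : ℂ)) ≠ 0 :=
    one_div_ne_zero (Nat.cast_ne_zero.2 n.factorial_ne_zero)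
  rw [metricPairing, LinearMap.smul_apply, smul_eq_mul, mul_eq_zero, or_iff_right hfac,
    LinearMap.sum_apply] at h0
  simp only [LinearMap.smul_apply, smul_eq_mul, evalForm_conj01, ← Complex.normSq_eq_conj_mul_self]
    at h0
  rw [← Complex.ofReal_sum, Complex.ofReal_eq_zero,
    Finset.sum_eq_zero_iff_of_nonneg fun _ _ => Complex.normSq_nonneg _] at h0
  have hz : ∀ I : Fin n → Fin (finrank ℝ V), evalForm 𝒥.forms01
      (fun j => stdOrthonormalBasis ℝ V (I j)) (ExteriorAlgebra.ιMulti ℂ n b) = 0 := fun I =>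
    Complex.normSq_eq_zero.1 (h0 I (Finset.mem_univ _))
  -- As a real-multilinear map the top form is determined by its values on tuples of basis vectors.
  let D : MultilinearMap ℝ (fun _ : Fin n => V) ℂ :=
    ((Matrix.detRowAlternating (R := ℂ) (n := Fin n)).toMultilinearMap.restrictScalars ℝ).compLinearMap
      fun _ => LinearMap.pi fun i => (b i : V →ₗ[ℝ] ℂ)
  have hD : ∀ w, D w = evalForm 𝒥.forms01 w (ExteriorAlgebra.ιMulti ℂ n b) := fun w => by
    rw [evalForm_ιMulti, ← Matrix.det_transpose]
    rfl
  have hD0 : D = 0 := by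
    refine Basis.ext_multilinear (fun _ => (stdOrthonormalBasis ℝ V).toBasis) fun I => ?_
    rw [hD]
    simpa using hz I
  have h1 : D v = 1 := by
    rw [hD, evalForm_ιMulti]
    convert Matrix.det_one (n := Fin n) (R := ℂ)
    ext i j
    have := congrArg (fun d : Dual ℂ 𝒥.forms01 => d (b i)) (hv j)
    change (b i : V →ₗ[ℝ] ℂ) (v j) = _ at this
    rw [Matrix.of_apply, this, Basis.coord_apply, Basis.repr_self, Finsupp.single_apply,
      Matrix.one_apply]
  rw [hD0] at h1
  exact zero_ne_one h1

variable {L : Type*} [AddCommGroup L] [Module ℂ L] (sq : L ⊗[ℂ] L ≃ₗ[ℂ] 𝒥.canonicalLine n)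

theorem spinPairing_tmul (α β : ExteriorAlgebra ℂ 𝒥.forms01) (s t : L) :
    𝒥.spinPairing L sq (α ⊗ₜ s) (β ⊗ₜ t)
      = 𝒥.metricPairing n (sq (s ⊗ₜ t)) (CliffordAlgebra.reverse α * β) := by
  simp only [spinPairing, metricPairing, LinearMap.smul_apply, LinearMap.sum_apply]
  congr 1

/-- Reversal moves a wedge across the product, and integration by parts moves a contraction. -/
theorem reverse_clif₀_mul (hV : finrank ℝ V = 2 * n) (κ : ExteriorAlgebra ℂ 𝒥.forms10) (v : V)
    (α β : ExteriorAlgebra ℂ 𝒥.forms01) :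
    𝒥.metricPairing n κ (CliffordAlgebra.reverse (𝒥.clif₀ v α) * β)
      = 𝒥.metricPairing n κ (CliffordAlgebra.reverse α * 𝒥.clif₀ v β) := by
  have h1 := apply_reverse_ctr_mul (f := 𝒥.metricPairing n κ)
    (fun k hk γ hγ => 𝒥.metricPairing_eq_zero (by rwa [𝒥.finrank_forms01 hV] at hk) κ hγ)
    (𝒥.ev01 v) α β
  have h2 : CliffordAlgebra.reverse (wdg (𝒥.flat01 v) α)
      = CliffordAlgebra.reverse α * ExteriorAlgebra.ι ℂ (𝒥.flat01 v) := by
    rw [LinearMap.mulLeft_apply]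
    exact (CliffordAlgebra.reverse.map_mul _ _).trans (congrArg _
      (CliffordAlgebra.reverse_ι (Q := (0 : QuadraticForm ℂ 𝒥.forms01)) _))
  rw [clif₀_eq]
  simp only [LinearMap.smul_apply, LinearMap.add_apply, map_smul, map_add, smul_mul_assoc,
    mul_smul_comm, add_mul, mul_add, h1, h2]
  rw [mul_assoc, LinearMap.mulLeft_apply]

/-- Clifford multiplication is symmetric for the spinor pairing. -/
theorem spinPairing_clif (hV : finrank ℝ V = 2 * n) (v : V) (ψ χ : 𝒥.Spinor L) :
    𝒥.spinPairing L sq (𝒥.clif L v ψ) χ = 𝒥.spinPairing L sq ψ (𝒥.clif L v χ) := by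
  induction ψ using TensorProduct.induction_on with
  | zero => simp
  | add x y hx hy => simp only [map_add, LinearMap.add_apply, hx, hy]
  | tmul α s =>
    induction χ using TensorProduct.induction_on with
    | zero => simp
    | add x y hx hy => simp only [map_add, hx, hy]
    | tmul β t =>
      rw [clif_tmul, clif_tmul, spinPairing_tmul, spinPairing_tmul, 𝒥.reverse_clif₀_mul hV]

theorem spinPairing_ne_zero (hV : finrank ℝ V = 2 * n) : 𝒥.spinPairing L sq ≠ 0 := by
  intro h0
  obtain ⟨κ, α, hne⟩ := 𝒥.exists_metricPairing_ne_zero hV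
  refine hne ?_
  clear hne
  obtain ⟨x, rfl⟩ := sq.surjective κ
  have hadd : ∀ κ κ' : ExteriorAlgebra ℂ 𝒥.forms10, 𝒥.metricPairing n (κ + κ') α
      = 𝒥.metricPairing n κ α + 𝒥.metricPairing n κ' α := fun κ κ' => by
    simp [metricPairing, add_mul, Finset.sum_add_distrib, mul_add]
  induction x using TensorProduct.induction_on with
  | zero => simp [metricPairing]
  | add x y hx hy => rw [map_add, Submodule.coe_add, hadd, hx, hy, add_zero]
  | tmul s t =>
    have := 𝒥.spinPairing_tmul sq 1 α s t
    rw [CliffordAlgebra.reverse.map_one, one_mul, h0] at this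
    exact this.symm

/-- By symmetry of Clifford multiplication the kernel is an invariant subspace; it is not
everything, so it is zero. -/
theorem spinPairing_bijective (hV : finrank ℝ V = 2 * n) :
    Function.Bijective (𝒥.spinPairing L sq : 𝒥.Spinor L →ₗ[ℂ] Dual ℂ (𝒥.Spinor L)) := by
  have hL := 𝒥.finrank_sqrt hV sq
  have : FiniteDimensional ℂ L := Module.finite_of_finrank_eq_succ hL
  have hker : LinearMap.ker (𝒥.spinPairing L sq) = ⊥ := by
    refine (𝒥.spinor_irreducible hL fun v ψ hψ => ?_).resolve_right fun htop => ?_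
    · rw [LinearMap.mem_ker] at hψ ⊢
      refine LinearMap.ext fun χ => ?_
      rw [𝒥.spinPairing_clif sq hV, hψ]
      rfl
    · exact 𝒥.spinPairing_ne_zero sq hV (LinearMap.ker_eq_top.1 htop)
  have hinj := LinearMap.ker_eq_bot.1 hker
  exact ⟨hinj, (LinearMap.injective_iff_surjective_of_finrank_eq_finrank
    (Subspace.dual_finrank_eq (K := ℂ) (V := 𝒥.Spinor L)).symm).1 hinj⟩

theorem qSharp_tmul (φ ψ : 𝒥.Spinor L) :
    𝒥.qSharp L sq (φ ⊗ₜ ψ) = (𝒥.spinPairing L sq ψ).smulRight φ := rfl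

theorem qSharp_bijective (hV : finrank ℝ V = 2 * n) : Function.Bijective (𝒥.qSharp L sq) := by
  have hL := 𝒥.finrank_sqrt hV sq
  have : FiniteDimensional ℂ L := Module.finite_of_finrank_eq_succ hL
  let e := TensorProduct.congr (LinearEquiv.refl ℂ (𝒥.Spinor L))
    (LinearEquiv.ofBijective _ (𝒥.spinPairing_bijective sq hV))
    ≪≫ₗ TensorProduct.comm ℂ _ _ ≪≫ₗ dualTensorHomEquiv ℂ (𝒥.Spinor L) (𝒥.Spinor L)
  have he : 𝒥.qSharp L sq = e.toLinearMap := by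
    refine TensorProduct.ext' fun φ ψ => LinearMap.ext fun χ => ?_
    simp [qSharp_tmul, e]
  rw [he]
  exact e.bijective

theorem clif_mul_qSharp (v : V) (φ ψ : 𝒥.Spinor L) :
    𝒥.clif L v * 𝒥.qSharp L sq (φ ⊗ₜ ψ) = 𝒥.qSharp L sq (𝒥.clif L v φ ⊗ₜ ψ) := by
  refine LinearMap.ext fun χ => ?_
  rw [Module.End.mul_apply, qSharp_tmul, qSharp_tmul, LinearMap.smulRight_apply,
    LinearMap.smulRight_apply, map_smul]

theorem qSharp_mul_clif (hV : finrank ℝ V = 2 * n) (v : V) (φ ψ : 𝒥.Spinor L) :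
    𝒥.qSharp L sq (φ ⊗ₜ ψ) * 𝒥.clif L v = 𝒥.qSharp L sq (φ ⊗ₜ 𝒥.clif L v ψ) := by
  refine LinearMap.ext fun χ => ?_
  rw [Module.End.mul_apply, qSharp_tmul, qSharp_tmul, LinearMap.smulRight_apply,
    LinearMap.smulRight_apply, 𝒥.spinPairing_clif sq hV]

end OrthComplexStructure
end Pairing

/-! ### Splitting the spin lifts along the graphs of `g` and `-g`. -/

section SpinLift

section LieBracket

variable {A : Type*} [Ring A] (a b x y u w : A) (c : ℂ)

theorem lie_add_lie_left :
    ⁅a + b, x⁆ + ⁅y, u + w⁆ = (⁅a, x⁆ + ⁅y, u⁆) + (⁅b, x⁆ + ⁅y, w⁆) := by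
  simp only [Ring.lie_def]; noncomm_ring

theorem lie_add_lie_right :
    ⁅y, u + w⁆ + ⁅a + b, x⁆ = (⁅y, u⁆ + ⁅a, x⁆) + (⁅y, w⁆ + ⁅b, x⁆) := by
  simp only [Ring.lie_def]; noncomm_ring

variable [Algebra ℂ A]

theorem smul_lie_add_lie_smul : ⁅c • a, x⁆ + ⁅y, c • u⁆ = c • (⁅a, x⁆ + ⁅y, u⁆) := by
  simp only [Ring.lie_def, smul_mul_assoc, mul_smul_comm, smul_sub, smul_add]

theorem lie_polarization : (1 / 4 : ℂ) • (⁅a, y⁆ + ⁅b, x⁆)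
    = (1 / 8 : ℂ) • (⁅a + b, x + y⁆ - ⁅a - b, x - y⁆) := by
  simp only [Ring.lie_def, add_mul, mul_add, sub_mul, mul_sub]
  module

theorem smul_sum_sub_neg_lie {I : Type*} [Fintype I] (f g h : I → A) :
    c • ∑ i, (f i - ⁅-g i, h i⁆) = c • ∑ i, f i - c • ∑ i, -⁅g i, h i⁆ := by
  rw [← smul_sub, ← Finset.sum_sub_distrib]
  refine congrArg _ (Finset.sum_congr rfl fun i _ => congrArg _ ?_)
  simp only [Ring.lie_def]
  noncomm_ring

end LieBracket

variable {V : Type*} [NormedAddCommGroup V] [InnerProductSpace ℝ V]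

/-- Both sides evaluate `T` on the canonical element of `V ⊗ V^*`. It allows an orthonormal basis in
`spinLift`, for which the coordinates are `g(eᵢ)`. -/
theorem sum_basis_coord {E : Type*} [AddCommGroup E] [Module ℝ E] (T : V →ₗ[ℝ] Dual ℝ V →ₗ[ℝ] E)
    {I J : Type*} [Fintype I] [Fintype J] (b : Basis I ℝ V) (c : Basis J ℝ V) :
    ∑ i, T (b i) (b.coord i) = ∑ j, T (c j) (c.coord j) := by
  have h1 : ∀ i, T (b i) (b.coord i) = ∑ j, T (c j) (c.coord j (b i) • b.coord i) := fun i => by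
    conv_lhs => rw [← c.sum_repr (b i), map_sum, LinearMap.sum_apply]
    exact Finset.sum_congr rfl fun j _ => by rw [map_smul, map_smul, LinearMap.smul_apply]; rfl
  have h2 : ∀ j, ∑ i, c.coord j (b i) • b.coord i = c.coord j := fun j => by
    refine b.ext fun k => ?_
    classical
    simp [Finsupp.single_apply]
  simp only [h1]
  rw [Finset.sum_comm]
  exact Finset.sum_congr rfl fun j _ => by rw [← map_sum, h2]

/-- The summand in the spin lift of `A`. -/
def spinLiftTerm (A : GTan V →ₗ[ℝ] GTan V) : V →ₗ[ℝ] Dual ℝ V →ₗ[ℝ] Module.End ℂ (Forms V) :=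
  LinearMap.mk₂ ℝ (fun v ξ => ⁅gact (A (v, 0)), gact ((0, ξ) : GTan V)⁆
      + ⁅gact (A (0, ξ)), gact ((v, 0) : GTan V)⁆)
    (fun v w ξ => by
      have h : ((v + w, 0) : GTan V) = (v, 0) + (w, 0) := by simp
      simp only [h, map_add, gact_add]
      exact lie_add_lie_left _ _ _ _ _ _)
    (fun r v ξ => by
      have h : ((r • v, 0) : GTan V) = r • (v, 0) := by simp
      simp only [h, map_smul, gact_smul]
      exact smul_lie_add_lie_smul _ _ _ _ _)
    (fun v ξ η => by
      have h : ((0, ξ + η) : GTan V) = (0, ξ) + (0, η) := by simp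
      simp only [h, map_add, gact_add]
      exact lie_add_lie_right _ _ _ _ _ _)
    (fun r v ξ => by
      have h : ((0, r • ξ) : GTan V) = r • (0, ξ) := by simp
      simp only [h, map_smul, gact_smul]
      refine (add_comm _ _).trans ((smul_lie_add_lie_smul _ _ _ _ _).trans ?_)
      rw [add_comm]
      rfl)

theorem gact_neg (A : GTan V) : gact (-A) = -gact A := by
  rw [← neg_one_smul ℝ A, gact_smul, Complex.ofReal_neg, Complex.ofReal_one]
  exact neg_one_smul ℂ (gact A)

/-- The element `v + g v` of the graph of `g`. -/
def graphPlus (v : V) : GTan V := (v, flat v)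

/-- The element `v - g v` of the graph of `-g`. -/
def graphMinus (v : V) : GTan V := (v, -flat v)

/-- The vectors `eᵢ ± g eᵢ` are orthogonal for the pairing with squares `± 2`, so their dual basis
is `± 1/2` times themselves; this gives the `1/8` and the minus sign. -/
theorem spinLift_eq_sum_graph [FiniteDimensional ℝ V] (A : GTan V →ₗ[ℝ] GTan V) :
    spinLift A = (1 / 8 : ℂ) • ∑ i,
      (⁅gact (A (graphPlus (stdOrthonormalBasis ℝ V i))),
          gact (graphPlus (stdOrthonormalBasis ℝ V i))⁆
        - ⁅gact (A (graphMinus (stdOrthonormalBasis ℝ V i))),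
          gact (graphMinus (stdOrthonormalBasis ℝ V i))⁆) := by
  have h1 : spinLift A = (1 / 4 : ℂ) • ∑ i, spinLiftTerm A (Module.finBasis ℝ V i)
      ((Module.finBasis ℝ V).coord i) := rfl
  rw [h1, sum_basis_coord _ (Module.finBasis ℝ V) (stdOrthonormalBasis ℝ V).toBasis,
    Finset.smul_sum, Finset.smul_sum]
  refine Finset.sum_congr rfl fun i _ => ?_
  have hc : (stdOrthonormalBasis ℝ V).toBasis.coord i = flat (stdOrthonormalBasis ℝ V i) := by
    ext w
    rw [Basis.coord_apply, OrthonormalBasis.coe_toBasis_repr_apply,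
      OrthonormalBasis.repr_apply_apply]
    rfl
  rw [hc, OrthonormalBasis.coe_toBasis]
  generalize stdOrthonormalBasis ℝ V i = v
  have hp : graphPlus v = ((v, 0) : GTan V) + (0, flat v) := by simp [graphPlus]
  have hm : graphMinus v = ((v, 0) : GTan V) + -(0, flat v) := by simp [graphMinus]
  rw [hp, hm, map_add, map_add, map_neg, gact_add, gact_add, gact_add, gact_add, gact_neg, gact_neg,
    ← sub_eq_add_neg, ← sub_eq_add_neg]
  exact lie_polarization _ _ _ _

namespace GKFibre

variable (G : GKFibre V)

theorem flat_injective : Function.Injective (flat : V → Dual ℝ V) := fun v w h => by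
  refine ext_inner_right ℝ fun z => ?_
  exact congrArg (fun f : Dual ℝ V => f z) h

theorem J₁_graphPlus (v : V) : G.J₁ (graphPlus v) = graphPlus (-G.Jplus.J v) := by
  have h := G.J₁_graph 1 (by norm_num) v
  have hJ : G.Jplus.J v = -(G.J₁ (v, (1 : ℝ) • flat v)).1 := rfl
  rw [one_smul] at hJ
  rw [one_smul, one_smul] at h
  rw [hJ, neg_neg]
  exact h

theorem J₁_graphMinus (v : V) : G.J₁ (graphMinus v) = graphMinus (-G.Jminus.J v) := by
  have h := G.J₁_graph (-1) (by norm_num) v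
  have hJ : G.Jminus.J v = -(G.J₁ (v, (-1 : ℝ) • flat v)).1 := rfl
  rw [neg_one_smul ℝ (flat v)] at hJ h
  rw [neg_one_smul ℝ (flat _)] at h
  rw [hJ, neg_neg]
  exact h

/-- Since `-𝕁₁ 𝕁₂` is `1` on the graph of `g`, `𝕁₂` equals `𝕁₁` there; on the graph of `-g` it is
`-1`, and `𝕁₂ = -𝕁₁`. -/
theorem J₂_graphPlus (v : V) : G.J₂ (graphPlus v) = graphPlus (-G.Jplus.J v) := by
  have h : -G.J₁ (G.J₂ (graphPlus v)) = graphPlus v :=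
    Prod.ext (flat_injective (G.metric_fst _)) (G.metric_snd _)
  have h2 := congrArg G.J₁ h
  rwa [map_neg, G.sq₁, neg_neg, G.J₁_graphPlus] at h2

theorem J₂_graphMinus (v : V) : G.J₂ (graphMinus v) = -graphMinus (-G.Jminus.J v) := by
  have h : -G.J₁ (G.J₂ (graphMinus v)) = -graphMinus v := by
    refine Prod.ext (flat_injective ?_) ?_
    · rw [G.metric_fst, Prod.fst_neg, map_neg]
      rfl
    · rw [G.metric_snd, Prod.snd_neg, graphMinus, neg_neg]
  have h2 := congrArg G.J₁ h
  rwa [map_neg, G.sq₁, neg_neg, map_neg, G.J₁_graphMinus] at h2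

variable [FiniteDimensional ℝ V]

/-- The part of the spin lift of `𝕁₁` that comes from the graph of `g`. -/
def liftPlus : Module.End ℂ (Forms V) :=
  (1 / 8 : ℂ) • ∑ i, ⁅gact (graphPlus (-G.Jplus.J (stdOrthonormalBasis ℝ V i))),
    gact (graphPlus (stdOrthonormalBasis ℝ V i))⁆

/-- The part of the spin lift of `𝕁₁` that comes from the graph of `-g`. -/
def liftMinus : Module.End ℂ (Forms V) :=
  (1 / 8 : ℂ) • ∑ i, -⁅gact (graphMinus (-G.Jminus.J (stdOrthonormalBasis ℝ V i))),
    gact (graphMinus (stdOrthonormalBasis ℝ V i))⁆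

theorem spinLift_J₁ : spinLift G.J₁ = G.liftPlus + G.liftMinus := by
  simp only [spinLift_eq_sum_graph, J₁_graphPlus, J₁_graphMinus, liftPlus, liftMinus,
    ← smul_add, ← Finset.sum_add_distrib, sub_eq_add_neg]

theorem spinLift_J₂ : spinLift G.J₂ = G.liftPlus - G.liftMinus := by
  simp only [spinLift_eq_sum_graph, J₂_graphPlus, J₂_graphMinus, liftPlus, liftMinus, gact_neg]
  exact smul_sum_sub_neg_lie _ _ _ _

end GKFibre
end SpinLift

/-! ### Eigenspaces on a tensor product, and the image of the vacuum lines. -/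

section Main

section TensorProduct

variable {S₁ S₂ F : Type*} [AddCommGroup S₁] [Module ℂ S₁] [AddCommGroup S₂] [Module ℂ S₂]
  [AddCommGroup F] [Module ℂ F]

/-- By flatness the first equation puts `t` in `A ⊗ S₂`; as `u ⊗ 1` is injective, the second
equation can be read there and puts `t` in `A ⊗ B`. -/
theorem mem_range_map_iff {A B : Type*} [AddCommGroup A] [Module ℂ A] [AddCommGroup B] [Module ℂ B]
    {u : A →ₗ[ℂ] S₁} {N₁ : Module.End ℂ S₁} (hu : Function.Injective u) (h₁ : Function.Exact u N₁)
    {v : B →ₗ[ℂ] S₂} {N₂ : Module.End ℂ S₂} (h₂ : Function.Exact v N₂) (t : S₁ ⊗[ℂ] S₂) :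
    t ∈ LinearMap.range (TensorProduct.map u v) ↔ N₁.rTensor S₂ t = 0 ∧ N₂.lTensor S₁ t = 0 := by
  have h1 := Module.Flat.rTensor_exact S₂ h₁
  have h2 := Module.Flat.lTensor_exact A h₂
  have hinj := Module.Flat.rTensor_preserves_injective_linearMap (M := S₂) u hu
  have hcomm : ∀ t', N₂.lTensor S₁ (u.rTensor S₂ t') = u.rTensor S₂ (N₂.lTensor A t') := fun t' => by
    rw [← LinearMap.comp_apply, LinearMap.lTensor_comp_rTensor, ← LinearMap.rTensor_comp_lTensor,
      LinearMap.comp_apply]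
  constructor
  · rintro ⟨x, rfl⟩
    rw [← LinearMap.rTensor_comp_lTensor, LinearMap.comp_apply]
    exact ⟨h1.apply_apply_eq_zero _, by rw [hcomm, h2.apply_apply_eq_zero, map_zero]⟩
  · rintro ⟨ht1, ht2⟩
    obtain ⟨t', rfl⟩ := (h1 t).1 ht1
    rw [hcomm] at ht2
    obtain ⟨x, rfl⟩ := (h2 t').1 (hinj (ht2.trans (map_zero _).symm))
    exact ⟨x, by rw [← LinearMap.rTensor_comp_lTensor, LinearMap.comp_apply]⟩

variable {I : Type*} [Fintype I] (Ψ : S₁ ⊗[ℂ] S₂ →ₗ[ℂ] F) {C D : I → Module.End ℂ F}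

/-- Operators that correspond to operators on the first factor. -/
theorem sum_lie_apply_rTensor {c d : I → Module.End ℂ S₁} {N : Module.End ℂ S₁} {r a b : ℂ}
    (hC : ∀ i φ ψ, C i (Ψ (φ ⊗ₜ ψ)) = Ψ (c i φ ⊗ₜ ψ))
    (hD : ∀ i φ ψ, D i (Ψ (φ ⊗ₜ ψ)) = Ψ (d i φ ⊗ₜ ψ))
    (hX : ∀ φ, r • ∑ i, (d i (c i φ) - c i (d i φ)) = a • (b • φ - N φ)) (t : S₁ ⊗[ℂ] S₂) :
    (r • ∑ i, ⁅D i, C i⁆) (Ψ t) = Ψ (a • (b • t - N.rTensor S₂ t)) := by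
  induction t using TensorProduct.induction_on with
  | zero => simp
  | add x y hx hy =>
    rw [map_add, map_add, hx, hy, ← map_add, (N.rTensor S₂).map_add]
    congr 1
    module
  | tmul φ ψ =>
    rw [LinearMap.rTensor_tmul, TensorProduct.smul_tmul', ← TensorProduct.sub_tmul,
      TensorProduct.smul_tmul', ← hX, ← TensorProduct.smul_tmul', TensorProduct.sum_tmul, map_smul,
      map_sum, LinearMap.smul_apply, LinearMap.sum_apply]
    refine congrArg _ (Finset.sum_congr rfl fun i _ => ?_)
    rw [Ring.lie_def, LinearMap.sub_apply, Module.End.mul_apply, Module.End.mul_apply, hC, hD, hD,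
      hC, TensorProduct.sub_tmul, map_sub]

/-- Operators whose products correspond to the opposite products on the second factor. -/
theorem sum_neg_lie_apply_lTensor {c d : I → Module.End ℂ S₂} {N : Module.End ℂ S₂} {r a b : ℂ}
    (hDC : ∀ i φ ψ, D i (C i (Ψ (φ ⊗ₜ ψ))) = -Ψ (φ ⊗ₜ d i (c i ψ)))
    (hCD : ∀ i φ ψ, C i (D i (Ψ (φ ⊗ₜ ψ))) = -Ψ (φ ⊗ₜ c i (d i ψ)))
    (hX : ∀ ψ, r • ∑ i, (d i (c i ψ) - c i (d i ψ)) = a • (b • ψ - N ψ)) (t : S₁ ⊗[ℂ] S₂) :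
    (r • ∑ i, -⁅D i, C i⁆) (Ψ t) = Ψ (a • (b • t - N.lTensor S₁ t)) := by
  induction t using TensorProduct.induction_on with
  | zero => simp
  | add x y hx hy =>
    rw [map_add, map_add, hx, hy, ← map_add, (N.lTensor S₁).map_add]
    congr 1
    module
  | tmul φ ψ =>
    rw [LinearMap.lTensor_tmul, ← TensorProduct.tmul_smul, ← TensorProduct.tmul_sub,
      ← TensorProduct.tmul_smul, ← hX, TensorProduct.tmul_smul, TensorProduct.tmul_sum, map_smul,
      map_sum, LinearMap.smul_apply, LinearMap.sum_apply]
    refine congrArg _ (Finset.sum_congr rfl fun i _ => ?_)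
    rw [Ring.lie_def, LinearMap.neg_apply, LinearMap.sub_apply, Module.End.mul_apply,
      Module.End.mul_apply, hDC, hCD, TensorProduct.tmul_sub, map_sub]
    abel

theorem eigenvalues_iff {E : Type*} [AddCommGroup E] [Module ℂ E] (n : ℂ) (t x y : E) :
    (Complex.I • ((n / 2) • t - x) + Complex.I • ((n / 2) • t - y) = (n * Complex.I) • t ∧
      Complex.I • ((n / 2) • t - x) - Complex.I • ((n / 2) • t - y) = (0 * Complex.I) • t) ↔
    x = 0 ∧ y = 0 := by
  have hI := Complex.I_mul_I
  constructor
  · rintro ⟨h1, h2⟩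
    rw [← sub_eq_zero] at h1 h2
    constructor
    -- The defects of the two equations add up to `-2 i x`, and their difference is `-2 i y`; hence
    -- the factor `i / 2`.
    · have h3 : x = (Complex.I / 2) • (Complex.I • ((n / 2) • t - x)
          + Complex.I • ((n / 2) • t - y) - (n * Complex.I) • t)
          + (Complex.I / 2) • (Complex.I • ((n / 2) • t - x)
          - Complex.I • ((n / 2) • t - y) - (0 * Complex.I) • t) := by
        match_scalars
        · linear_combination hI
        · ring
        · ring
      rw [h3, h1, h2, smul_zero, add_zero]
    · have h3 : y = (Complex.I / 2) • (Complex.I • ((n / 2) • t - x)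
          + Complex.I • ((n / 2) • t - y) - (n * Complex.I) • t)
          - (Complex.I / 2) • (Complex.I • ((n / 2) • t - x)
          - Complex.I • ((n / 2) • t - y) - (0 * Complex.I) • t) := by
        match_scalars
        · linear_combination hI
        · ring
        · ring
      rw [h3, h1, h2, smul_zero, sub_zero]
  · rintro ⟨rfl, rfl⟩
    constructor <;> module

theorem mem_eigenspace_inf_iff {Ψ : S₁ ⊗[ℂ] S₂ →ₗ[ℂ] F} (hΨ : Function.Injective Ψ)
    {P Q : Module.End ℂ F} {N₁ : Module.End ℂ S₁} {N₂ : Module.End ℂ S₂} {n : ℂ}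
    (hP : ∀ t, P (Ψ t) = Ψ (Complex.I • ((n / 2) • t - N₁.rTensor S₂ t)))
    (hQ : ∀ t, Q (Ψ t) = Ψ (Complex.I • ((n / 2) • t - N₂.lTensor S₁ t))) (t : S₁ ⊗[ℂ] S₂) :
    Ψ t ∈ Module.End.eigenspace (P + Q) (n * Complex.I)
        ⊓ Module.End.eigenspace (P - Q) (0 * Complex.I)
      ↔ N₁.rTensor S₂ t = 0 ∧ N₂.lTensor S₁ t = 0 := by
  rw [Submodule.mem_inf, Module.End.mem_eigenspace_iff, Module.End.mem_eigenspace_iff,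
    LinearMap.add_apply, LinearMap.sub_apply, hP, hQ, ← map_add, ← map_sub, ← map_smul, ← map_smul,
    hΨ.eq_iff, hΨ.eq_iff, eigenvalues_iff]

end TensorProduct


variable {V : Type*} [NormedAddCommGroup V] [InnerProductSpace ℝ V]

theorem linInv_apply {A B : Type*} [AddCommMonoid A] [Module ℂ A] [AddCommMonoid B] [Module ℂ B]
    {f : A →ₗ[ℂ] B} (hf : Function.Bijective f) (b : B) : f (linInv f b) = b := by
  rw [linInv, dif_pos hf]
  exact LinearEquiv.apply_symm_apply (LinearEquiv.ofBijective f hf) b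

theorem linInv_bijective {A B : Type*} [AddCommMonoid A] [Module ℂ A] [AddCommMonoid B]
    [Module ℂ B] {f : A →ₗ[ℂ] B} (hf : Function.Bijective f) : Function.Bijective (linInv f) := by
  rw [linInv, dif_pos hf]
  exact (LinearEquiv.ofBijective f hf).symm.bijective

/-! ### Bijectivity and equivariance of `q^♭`. -/

section Equivariance

variable [FiniteDimensional ℝ V] {n : ℕ} {𝒥₁ 𝒥₂ : OrthComplexStructure V} {L₁ L₂ : Type*} [AddCommGroup L₁] [Module ℂ L₁]
  [AddCommGroup L₂] [Module ℂ L₂] (sq : L₁ ⊗[ℂ] L₁ ≃ₗ[ℂ] 𝒥₁.canonicalLine n)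
  {p : 𝒥₂.Spinor L₂ ≃ₗ[ℂ] 𝒥₁.Spinor L₁}

theorem qFlat_tmul (φ : 𝒥₁.Spinor L₁) (ψ : 𝒥₂.Spinor L₂) :
    qFlat 𝒥₁ 𝒥₂ L₁ L₂ sq p (φ ⊗ₜ ψ)
      = symbolMap (linInv (𝒥₁.spinRep L₁) (𝒥₁.qSharp L₁ sq (φ ⊗ₜ p ψ))) := rfl

theorem qFlat_bijective (hV : finrank ℝ V = 2 * n) :
    Function.Bijective (qFlat 𝒥₁ 𝒥₂ L₁ L₂ sq p) := by
  have h1 : Function.Bijective (TensorProduct.map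
      (LinearMap.id : 𝒥₁.Spinor L₁ →ₗ[ℂ] 𝒥₁.Spinor L₁) p.toLinearMap) :=
    (TensorProduct.congr (LinearEquiv.refl ℂ (𝒥₁.Spinor L₁)) p).bijective
  have h2 := 𝒥₁.qSharp_bijective sq hV
  have h3 := linInv_bijective (𝒥₁.spinRep_bijective hV (𝒥₁.finrank_sqrt hV sq))
  exact symbolMap_bijective.comp (h3.comp (h2.comp h1))

theorem ι_mul_linInv (hV : finrank ℝ V = 2 * n) (v : V) (φ ψ : 𝒥₁.Spinor L₁) :
    (1 ⊗ₜ CliffordAlgebra.ι (metricForm V) v) * linInv (𝒥₁.spinRep L₁) (𝒥₁.qSharp L₁ sq (φ ⊗ₜ ψ))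
      = linInv (𝒥₁.spinRep L₁) (𝒥₁.qSharp L₁ sq (𝒥₁.clif L₁ v φ ⊗ₜ ψ)) := by
  have hρ := 𝒥₁.spinRep_bijective hV (𝒥₁.finrank_sqrt hV sq)
  apply hρ.1
  rw [𝒥₁.spinRep_mul, 𝒥₁.spinRep_ι, linInv_apply hρ, linInv_apply hρ, 𝒥₁.clif_mul_qSharp]

theorem linInv_mul_ι (hV : finrank ℝ V = 2 * n) (v : V) (φ ψ : 𝒥₁.Spinor L₁) :
    linInv (𝒥₁.spinRep L₁) (𝒥₁.qSharp L₁ sq (φ ⊗ₜ ψ)) * (1 ⊗ₜ CliffordAlgebra.ι (metricForm V) v)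
      = linInv (𝒥₁.spinRep L₁) (𝒥₁.qSharp L₁ sq (φ ⊗ₜ 𝒥₁.clif L₁ v ψ)) := by
  have hρ := 𝒥₁.spinRep_bijective hV (𝒥₁.finrank_sqrt hV sq)
  apply hρ.1
  rw [𝒥₁.spinRep_mul, 𝒥₁.spinRep_ι, linInv_apply hρ, linInv_apply hρ, 𝒥₁.qSharp_mul_clif sq hV]

theorem gact_graphPlus_qFlat (hV : finrank ℝ V = 2 * n) (v : V) (φ : 𝒥₁.Spinor L₁)
    (ψ : 𝒥₂.Spinor L₂) :
    gact (graphPlus v) (qFlat 𝒥₁ 𝒥₂ L₁ L₂ sq p (φ ⊗ₜ ψ))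
      = qFlat 𝒥₁ 𝒥₂ L₁ L₂ sq p (𝒥₁.clif L₁ v φ ⊗ₜ ψ) := by
  rw [qFlat_tmul, qFlat_tmul, graphPlus, ← symbolMap_ι_mul, ι_mul_linInv sq hV]

/-- A single `v - g v` would bring in the parity involution; products of two do not, and the spin
lift consists of commutators. The minus sign cancels the one in `liftMinus`. -/
theorem gact_graphMinus_qFlat (hV : finrank ℝ V = 2 * n)
    (hp : ∀ (v : V) (ψ : 𝒥₂.Spinor L₂), p (𝒥₂.clif L₂ v ψ) = 𝒥₁.clif L₁ v (p ψ))
    (v w : V) (φ : 𝒥₁.Spinor L₁) (ψ : 𝒥₂.Spinor L₂) :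
    gact (graphMinus w) (gact (graphMinus v) (qFlat 𝒥₁ 𝒥₂ L₁ L₂ sq p (φ ⊗ₜ ψ)))
      = -qFlat 𝒥₁ 𝒥₂ L₁ L₂ sq p (φ ⊗ₜ 𝒥₂.clif L₂ w (𝒥₂.clif L₂ v ψ)) := by
  have h1 : p (𝒥₂.clif L₂ w (𝒥₂.clif L₂ v ψ)) = 𝒥₁.clif L₁ w (𝒥₁.clif L₁ v (p ψ)) :=
    (hp w _).trans (congrArg _ (hp v ψ))
  have h2 := symbolMap_mul_ι_mul_ι v w
    (linInv (𝒥₁.spinRep L₁) (𝒥₁.qSharp L₁ sq (φ ⊗ₜ p ψ)))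
  rw [linInv_mul_ι sq hV, linInv_mul_ι sq hV, ← h1] at h2
  exact neg_eq_iff_eq_neg.1 h2.symm

end Equivariance

/-! ### The vacuum line as the kernel of the spinor degree. -/

namespace OrthComplexStructure

variable (𝒥 : OrthComplexStructure V) {n : ℕ} (L : Type*) [AddCommGroup L] [Module ℂ L]

theorem vacuum_eq : 𝒥.vacuum L = (Algebra.linearMap ℂ (ExteriorAlgebra ℂ 𝒥.forms01)).rTensor L
    ∘ₗ (TensorProduct.lid ℂ L).symm.toLinearMap := by
  ext s
  simp [vacuum]

theorem vacuum_injective : Function.Injective (𝒥.vacuum L) := by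
  have h : Function.Injective (Algebra.linearMap ℂ (ExteriorAlgebra ℂ 𝒥.forms01)) :=
    (ExteriorAlgebra.algebraMap_leftInverse 𝒥.forms01).injective
  rw [vacuum_eq]
  exact (Module.Flat.rTensor_preserves_injective_linearMap (M := L) _ h).comp
    (TensorProduct.lid ℂ L).symm.injective

variable [FiniteDimensional ℝ V]

/-- The degree operator on spinors. -/
def spinorDegree : Module.End ℂ (𝒥.Spinor L) := 𝒥.degreeOp.rTensor L

theorem sum_lie_clif_J (hV : finrank ℝ V = 2 * n) (φ : 𝒥.Spinor L) :
    (1 / 8 : ℂ) • ∑ i, (𝒥.clif L (-𝒥.J (stdOrthonormalBasis ℝ V i))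
        (𝒥.clif L (stdOrthonormalBasis ℝ V i) φ)
      - 𝒥.clif L (stdOrthonormalBasis ℝ V i)
        (𝒥.clif L (-𝒥.J (stdOrthonormalBasis ℝ V i)) φ))
    = Complex.I • ((n / 2 : ℂ) • φ - 𝒥.spinorDegree L φ) := by
  induction φ using TensorProduct.induction_on with
  | zero => simp
  | add x y hx hy =>
    have h : ∀ a b c d : 𝒥.Spinor L, a + b - (c + d) = (a - c) + (b - d) := fun a b c d => by abel
    simp only [map_add, h, Finset.sum_add_distrib, smul_add, hx, hy]
  | tmul α s =>
    have h := LinearMap.congr_fun (𝒥.sum_lie_clif₀_J hV) α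
    simp only [LinearMap.smul_apply, LinearMap.sum_apply, LinearMap.sub_apply,
      LinearMap.id_apply] at h
    have h2 : ∀ i, ⁅𝒥.clif₀ (-𝒥.J (stdOrthonormalBasis ℝ V i)),
        𝒥.clif₀ (stdOrthonormalBasis ℝ V i)⁆ α
        = 𝒥.clif₀ (-𝒥.J (stdOrthonormalBasis ℝ V i)) (𝒥.clif₀ (stdOrthonormalBasis ℝ V i) α)
          - 𝒥.clif₀ (stdOrthonormalBasis ℝ V i) (𝒥.clif₀ (-𝒥.J (stdOrthonormalBasis ℝ V i)) α) :=
      fun i => rfl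
    simp only [h2] at h
    simp only [clif_tmul, spinorDegree, LinearMap.rTensor_tmul, ← TensorProduct.sub_tmul,
      ← TensorProduct.sum_tmul, TensorProduct.smul_tmul', h]

theorem exact_vacuum : Function.Exact (𝒥.vacuum L) (𝒥.spinorDegree L) := by
  have h : Function.Exact (Algebra.linearMap ℂ (ExteriorAlgebra ℂ 𝒥.forms01)) 𝒥.degreeOp :=
    LinearMap.exact_iff.2 𝒥.ker_degreeOp
  have h2 := Module.Flat.rTensor_exact L h
  intro x
  rw [vacuum_eq, LinearMap.coe_comp, LinearEquiv.coe_coe,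
    (TensorProduct.lid ℂ L).symm.surjective.range_comp]
  exact h2 x

end OrthComplexStructure

/-! ### The theorem in one tangent space. -/

section Fibre

variable [FiniteDimensional ℝ V] {n : ℕ} (G : GKFibre V)
  {L₁ L₂ : Type*} [AddCommGroup L₁] [Module ℂ L₁] [AddCommGroup L₂] [Module ℂ L₂]
  (sq : L₁ ⊗[ℂ] L₁ ≃ₗ[ℂ] G.Jplus.canonicalLine n)
  {p : G.Jminus.Spinor L₂ ≃ₗ[ℂ] G.Jplus.Spinor L₁}

theorem liftPlus_qFlat (hV : finrank ℝ V = 2 * n)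
    (t : G.Jplus.Spinor L₁ ⊗[ℂ] G.Jminus.Spinor L₂) :
    G.liftPlus (qFlat G.Jplus G.Jminus L₁ L₂ sq p t)
      = qFlat G.Jplus G.Jminus L₁ L₂ sq p (Complex.I • ((n / 2 : ℂ) • t
        - (G.Jplus.spinorDegree L₁).rTensor (G.Jminus.Spinor L₂) t)) := by
  exact sum_lie_apply_rTensor (qFlat G.Jplus G.Jminus L₁ L₂ sq p)
    (fun i => gact_graphPlus_qFlat sq hV (stdOrthonormalBasis ℝ V i))
    (fun i => gact_graphPlus_qFlat sq hV (-G.Jplus.J (stdOrthonormalBasis ℝ V i)))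
    (G.Jplus.sum_lie_clif_J L₁ hV) t

theorem liftMinus_qFlat (hV : finrank ℝ V = 2 * n)
    (hp : ∀ (v : V) (ψ : G.Jminus.Spinor L₂), p (G.Jminus.clif L₂ v ψ) = G.Jplus.clif L₁ v (p ψ))
    (t : G.Jplus.Spinor L₁ ⊗[ℂ] G.Jminus.Spinor L₂) :
    G.liftMinus (qFlat G.Jplus G.Jminus L₁ L₂ sq p t)
      = qFlat G.Jplus G.Jminus L₁ L₂ sq p (Complex.I • ((n / 2 : ℂ) • t
        - (G.Jminus.spinorDegree L₂).lTensor (G.Jplus.Spinor L₁) t)) := by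
  exact sum_neg_lie_apply_lTensor (qFlat G.Jplus G.Jminus L₁ L₂ sq p)
    (fun i => gact_graphMinus_qFlat sq hV hp (stdOrthonormalBasis ℝ V i)
      (-G.Jminus.J (stdOrthonormalBasis ℝ V i)))
    (fun i => gact_graphMinus_qFlat sq hV hp (-G.Jminus.J (stdOrthonormalBasis ℝ V i))
      (stdOrthonormalBasis ℝ V i))
    (G.Jminus.sum_lie_clif_J L₂ hV) t

theorem qFlat_mem_U_iff (hV : finrank ℝ V = 2 * n)
    (hp : ∀ (v : V) (ψ : G.Jminus.Spinor L₂), p (G.Jminus.clif L₂ v ψ) = G.Jplus.clif L₁ v (p ψ))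
    (t : G.Jplus.Spinor L₁ ⊗[ℂ] G.Jminus.Spinor L₂) :
    qFlat G.Jplus G.Jminus L₁ L₂ sq p t ∈ G.U n 0 ↔
      t ∈ LinearMap.range (TensorProduct.map (G.Jplus.vacuum L₁) (G.Jminus.vacuum L₂)) := by
  have h1 := mem_range_map_iff (G.Jplus.vacuum_injective L₁) (G.Jplus.exact_vacuum L₁)
    (G.Jminus.exact_vacuum L₂) t
  have h2 := mem_eigenspace_inf_iff (qFlat_bijective sq hV).1 (liftPlus_qFlat G sq (p := p) hV)
    (liftMinus_qFlat G sq hV hp) t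
  rw [← G.spinLift_J₁, ← G.spinLift_J₂, ← Int.cast_natCast, ← Int.cast_zero] at h2
  exact h2.trans h1.symm

/-- The image under `q^♭` of the product of the vacuum lines is `U_{n,0}`. -/
theorem map_qFlat_vacuum (hV : finrank ℝ V = 2 * n)
    (hp : ∀ (v : V) (ψ : G.Jminus.Spinor L₂), p (G.Jminus.clif L₂ v ψ) = G.Jplus.clif L₁ v (p ψ)) :
    Submodule.map (qFlat G.Jplus G.Jminus L₁ L₂ sq p)
      (LinearMap.range (TensorProduct.map (G.Jplus.vacuum L₁) (G.Jminus.vacuum L₂))) = G.U n 0 := by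
  refine le_antisymm ?_ fun Φ hΦ => ?_
  · rintro _ ⟨t, ht, rfl⟩
    exact (qFlat_mem_U_iff G sq hV hp t).2 ht
  · obtain ⟨t, rfl⟩ := (qFlat_bijective sq (p := p) hV).2 Φ
    exact ⟨t, (qFlat_mem_U_iff G sq hV hp t).1 hΦ, rfl⟩

end Fibre
end Main

end GenKahler

theorem proposition4p4 {n : ℕ} {M : Type*} [TopologicalSpace M]
    [ChartedSpace (EuclideanSpace ℝ (Fin (2 * n))) M] [IsManifold (𝓡 (2 * n)) ∞ M]
    [Bundle.RiemannianBundle (fun x : M => TangentSpace (𝓡 (2 * n)) x)]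
    [IsContMDiffRiemannianBundle (𝓡 (2 * n)) ∞ (EuclideanSpace ℝ (Fin (2 * n)))
      (fun x : M => TangentSpace (𝓡 (2 * n)) x)]
    -- a generalized Kähler structure on `M`
    (𝒢 : GenKahler.GKStructure n M)
    -- square roots `K₊^{1/2}`, `K₋^{1/2}` of the canonical line bundles of `J₊`, `J₋`
    (Lp Lm : M → Type*)
    [∀ x, AddCommGroup (Lp x)] [∀ x, Module ℂ (Lp x)]
    [∀ x, AddCommGroup (Lm x)] [∀ x, Module ℂ (Lm x)]
    (sqp : ∀ x, Lp x ⊗[ℂ] Lp x ≃ₗ[ℂ] (𝒢.Jp x).canonicalLine n)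
    (sqm : ∀ x, Lm x ⊗[ℂ] Lm x ≃ₗ[ℂ] (𝒢.Jm x).canonicalLine n)
    -- a `Cl(T, g)`-equivariant isomorphism `p : S₂ → S₁`
    (p : ∀ x, (𝒢.Jm x).Spinor (Lm x) ≃ₗ[ℂ] (𝒢.Jp x).Spinor (Lp x))
    (hp : ∀ x (v : TangentSpace (𝓡 (2 * n)) x) (ψ : (𝒢.Jm x).Spinor (Lm x)),
      p x ((𝒢.Jm x).clif (Lm x) v ψ) = (𝒢.Jp x).clif (Lp x) v (p x ψ)) :
    ∀ x : M,
      -- the representation `ρ` that is inverted in `q^♭` is an isomorphism onto `End(S₁)`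
      Function.Bijective ((𝒢.Jp x).spinRep (Lp x)) ∧
      -- `q^♭` is an isomorphism
      Function.Bijective (GenKahler.qFlat (𝒢.Jp x) (𝒢.Jm x) (Lp x) (Lm x) (sqp x) (p x)) ∧
      -- the image of `K₊^{1/2} ⊗ K₋^{1/2}` is `U_{n,0}`
      Submodule.map (GenKahler.qFlat (𝒢.Jp x) (𝒢.Jm x) (Lp x) (Lm x) (sqp x) (p x))
          (LinearMap.range (TensorProduct.map
            ((𝒢.Jp x).vacuum (Lp x)) ((𝒢.Jm x).vacuum (Lm x))))
        = (𝒢.fibre x).U n 0 := by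
  intro x
  have hV : finrank ℝ (TangentSpace (𝓡 (2 * n)) x) = 2 * n :=
    finrank_euclideanSpace_fin
  have hL := (𝒢.Jp x).finrank_sqrt hV (sqp x)
  exact ⟨(𝒢.Jp x).spinRep_bijective hV hL, GenKahler.qFlat_bijective (sqp x) hV,
    GenKahler.map_qFlat_vacuum (𝒢.fibre x) (sqp x) hV (hp x)⟩
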